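/- **Setting.** Let $N\ge 1$, $A_k\in\mathbb R^{n\times n}$, $B_k\in\mathbb R^{n\times m}$, $R_k\succ 0$ ($0\le k<N$), $Q_k\succeq 0$ and $x_k'\in\mathbb R^n$ ($0\le k\le N$), $\kappa>0$. Consider $x_{k+1}=A_kx_k+B_ku_k$ and the cost $$J=\|x_N-x_N'\|_{Q_N}^2+\sum_{k<N}\big(\|u_k\|_{R_k}^2+\|x_k-x_k'\|_{Q_k}^2\big),\qquad \|v\|_S^2=v^{\mathsf T}Sv .$$ Put $\Phi_{k_2,k_1}=A_{k_2-1}\cdots A_{k_1}$, $\Phi=\Phi_{N,0}$, $\mathbf B=[\Phi_{N,1}B_0,\dots,\Phi_{N,N}B_{N-1}]$, and assume that the controllability Gramian $\mathcal G=\mathbf B\mathbf B^{\mathsf T}$ is nonsingular. Let $\mathbf\Gamma,\mathbf H$ be the block matrices with $\mathbf X=\mathbf\Gamma x_0+\mathbf H\mathbf U$ for the stacked states $\mathbf X=(x_0,\dots,x_N)$ and inputs $\mathbf U=(u_0,\dots,u_{N-1})$, $\mathbf R=\mathrm{bdiag}(R_k)$, $\mathbf Q=\mathrm{bdiag}(Q_k)$,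 $\mathbf X'=(x_0',\dots,x_N')$, $M=\mathbf R+\mathbf H^{\mathsf T}\mathbf Q\mathbf H$. The initial state is distributed as the Gaussian mixture $\sum_{i<r}p_i^0\,\mathcal N(\mu_i^0,\Sigma_i^0)$, and the target is the mixture $\rho_d=\sum_{j<t}p_j^d\,\mathcal N(\mu_j^d,\Sigma_j^d)$, with probability vectors $\mathbf p_0,\mathbf p_d$ and all covariances positive definite. Fix a number $q$ of terminal components. For mixtures $\sum_i p_i\mathcal N(\mu_i,\Sigma_i)$ and $\sum_j p'_j\mathcal N(\mu'_j,\Sigma'_j)$ let $W_{\mathrm{GMM}}^2$ be the minimum of $\sum_{i,j}M_{ij}W_{\mathcal N}^2(\mu_i,\Sigma_i,\mu'_j,\Sigma'_j)$ over matrices $M\ge 0$ with $M\mathbf 1=\mathbf p$, $M^{\mathsf T}\mathbf 1=\mathbf p'$, where $W_{\mathcal N}^2(\mu,\Sigma,\mu',\Sigma')=\|\mu-\mu'\|_2^2+\mathrm{tr}(\Sigma+\Sigma')-2\,\mathrm{tr}\big((\Sigma'^{1/2}\Sigma\,\Sigma'^{1/2})^{1/2}\big)$. **Policies.** A policy $\pi\in\Pi_r$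 has parameters $\lambda_{ij}\ge 0$ with $\sum_j\lambda_{ij}=1$, $\mathbf L_{ij}\in\mathbb R^{mN\times n}$, $\bar{\mathbf U}_{ij}\in\mathbb R^{mN}$ ($i<r$, $j<q$). Given $x_0$ it applies the whole control sequence $\mathbf U=\mathbf L_{ij}(x_0-\mu_i^0)+\bar{\mathbf U}_{ij}$ with probability $\lambda_{ij}\ell_i(x_0)$, where $\ell_i(x_0)$ is the posterior probability of the $i$-th component of the initial mixture given $x_0$. **Problem (P):** over those $\pi\in\Pi_r$ for which the law of $x_N$ is a Gaussian mixture $\rho_N=\sum_{j<q}p_j^N\mathcal N(\mu_j^N,\Sigma_j^N)$ with $q$ components ($\Sigma_j^N\succeq0$) and $\mathbb E[J]\le\kappa$, minimize $W_{\mathrm{GMM}}^2(\rho_N,\rho_d)$. **Component problems.** Mean steering from $\mu_0$ to $\mu_d$: minimize $J_{\mathrm{mean}}(\bar{\mathbf U};\mu_0)=\bar{\mathbf U}^{\mathsf T}\mathbf R\bar{\mathbf U}+(\mathbf\Gamma\mu_0+\mathbf H\bar{\mathbf U}-\mathbf X')^{\mathsf T}\mathbf Q(\mathbf\Gamma\mu_0+\mathbf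 H\bar{\mathbf U}-\mathbf X')$ subject to $\mu_d=\Phi\mu_0+\mathbf B\bar{\mathbf U}$. Covariance steering from $\Sigma_0$ to $\Sigma_d$: minimize $\mathrm{tr}(\mathbf R\mathbf L\Sigma_0\mathbf L^{\mathsf T})+\mathrm{tr}\big(\mathbf Q(\mathbf\Gamma+\mathbf H\mathbf L)\Sigma_0(\mathbf\Gamma+\mathbf H\mathbf L)^{\mathsf T}\big)$ subject to $\Sigma_d=(\Phi+\mathbf B\mathbf L)\Sigma_0(\Phi+\mathbf B\mathbf L)^{\mathsf T}$. Let $J^\star_{\mathrm{mean}}(\mu_0,\mu_d)=J_{\mathrm{mean}}(\bar{\mathbf U}^\star;\mu_0)$, where, with $Y_0=\mathbf\Gamma\mu_0-\mathbf X'$, $\bar{\mathbf U}^\star=\tfrac12M^{-1}(\mathbf B^{\mathsf T}\Lambda^\star-2\mathbf H^{\mathsf T}\mathbf QY_0)$ and $\Lambda^\star=2(\mathbf BM^{-1}\mathbf B^{\mathsf T})^{-1}(\mathbf BM^{-1}\mathbf H^{\mathsf T}\mathbf QY_0+\mu_d-\Phi\mu_0)$. Let $D\in\mathbb R^{mN\times(mN-n)}$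 be any matrix of full rank with $\mathbf BD=0$, and put $\Theta_1=I-D(D^{\mathsf T}MD)^{-1}D^{\mathsf T}M$, $\Theta_2=D(D^{\mathsf T}MD)^{-1}D^{\mathsf T}\mathbf H^{\mathsf T}\mathbf Q\mathbf\Gamma$, $\Theta_3=\mathbf B^{\mathsf T}\mathcal G^{-1}\Phi$, $\Theta_4=\Theta_1\Theta_3+\Theta_2$, $\Theta_5=\mathbf\Gamma-\mathbf H\Theta_4$, $\Theta_6=\mathcal G^{-1}\mathbf B\Theta_1^{\mathsf T}M\Theta_1\mathbf B^{\mathsf T}\mathcal G^{-\mathsf T}$, $\Theta_7=\Theta_4^{\mathsf T}\mathbf R\Theta_4+\Theta_5^{\mathsf T}\mathbf Q\Theta_5$, $\Theta_8=(\Theta_5^{\mathsf T}\mathbf Q\mathbf H-\Theta_4^{\mathsf T}\mathbf R)\Theta_1\mathbf B^{\mathsf T}\mathcal G^{-1}$. **Bilinear program (B)** in the variables $\tilde{\boldsymbol\lambda},\mathbf C\in\mathbb R^{r\times q}$, $\boldsymbol\beta,\mathbf T\in\mathbb R^{q\times t}$, $\mathbf p_N\in\mathbb R^q$, $\mu_j^N\in\mathbb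 R^n$, $\Sigma_j^N\in\mathbb R^{n\times n}$, $L_{ij},Y_{ij}\in\mathbb R^{n\times n}$: minimize $\mathrm{tr}(\mathbf T^{\mathsf T}\boldsymbol\beta)$ subject to, for all indices, $$\tilde{\boldsymbol\lambda}\mathbf 1=\mathbf p_0,\quad \tilde{\boldsymbol\lambda}^{\mathsf T}\mathbf 1=\mathbf p_N,\quad \tilde{\boldsymbol\lambda}\ge0,\qquad \boldsymbol\beta\mathbf 1=\mathbf p_N,\quad \boldsymbol\beta^{\mathsf T}\mathbf 1=\mathbf p_d,\quad \boldsymbol\beta\ge0,$$ $$\mathbf C_{ij}\ge J^\star_{\mathrm{mean}}(\mu_i^0,\mu_j^N)+\mathrm{tr}(\Theta_6\Sigma_j^N)+\mathrm{tr}(\Theta_7\Sigma_i^0)+\mathrm{tr}(L_{ij}+L_{ij}^{\mathsf T}),\qquad \begin{bmatrix}\Theta_8\Sigma_j^N\Theta_8^{\mathsf T}&L_{ij}\\L_{ij}^{\mathsf T}&\Sigma_i^0\end{bmatrix}\succeq0,$$ $$\mathbf T_{ij}\ge\|\mu_j^d-\mu_i^N\|_2^2+\mathrm{tr}(\Sigma_i^N)+\mathrm{tr}(\Sigma_j^d)+\mathrm{tr}(Y_{ij}+Y_{ij}^{\mathsf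 T}),\qquad \begin{bmatrix}\Sigma_i^N&Y_{ij}\\Y_{ij}^{\mathsf T}&\Sigma_j^d\end{bmatrix}\succeq0,\qquad \mathrm{tr}(\mathbf C^{\mathsf T}\tilde{\boldsymbol\lambda})\le\kappa .$$ A policy is *recovered* from a point of (B) if $\lambda_{ij}=\tilde\lambda_{ij}/p_i^0$ whenever $p_i^0\ne0$ (the row of $\lambda$ is an arbitrary probability vector if $p_i^0=0$), $\bar{\mathbf U}_{ij}$ solves mean steering from $\mu_i^0$ to $\mu_j^N$, and $\mathbf L_{ij}$ solves covariance steering from $\Sigma_i^0$ to $\Sigma_j^N$, for all $i,j$. **Theorem 3.** Problems (P) and (B) are equivalent: 1. (P) is feasible if and only if (B) is, and their optimal values (infima) coincide. 2. For every policy feasible for (P), with terminal mixture $\rho_N$, there is a feasible point of (B) with the same terminal parameters $(\mathbf p_N,\mu_j^N,\Sigma_j^N)$ and objective value $W_{\mathrm{GMM}}^2(\rho_N,\rho_d)$. 3. From every feasible point of (B) at least one policy can be recovered, and every recovered policy is feasible for (P), its terminal mixture has the parameters $(\mathbf p_N,\mu_j^N,\Sigma_j^N)$ of the point, and $W_{\mathrm{GMM}}^2(\rho_N,\rho_d)$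 is at most the objective value of the point. 4. If the point is a global minimizer of (B), then every policy recovered from it is optimal for (P), with $W_{\mathrm{GMM}}^2(\rho_N,\rho_d)$ equal to the optimal value of (B). 5. Conversely, for every policy optimal for (P) there is a global minimizer of (B) with the same terminal mixture parameters and the same value. -/

import Mathlib

open MeasureTheory ProbabilityTheory Matrix
open scoped MatrixOrder

noncomputable section

namespace GMMSteering

/-! ## Gaussian mixtures and the GMM-Wasserstein distance -/

/-- The parameters of a Gaussian mixture on `ℝⁿ` with `r` components. -/
structure GMM (n r : ℕ) where
  /-- the weights -/
  weight : Fin r → ℝ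
  /-- the means of the components -/
  mean : Fin r → EuclideanSpace ℝ (Fin n)
  /-- the covariance matrices of the components -/
  cov : Fin r → Matrix (Fin n) (Fin n) ℝ

/-- The weights form a probability vector and the covariances are positive semidefinite
(a component may be degenerate, that is, concentrated on an affine subspace). -/
structure GMM.IsValid {n r : ℕ} (G : GMM n r) : Prop where
  weight_mem : G.weight ∈ stdSimplex ℝ (Fin r)
  cov_posSemidef : ∀ i, (G.cov i).PosSemidef

/-- The weights form a probability vector and the covariances are positive definite. -/
structure GMM.IsNondegenerate {n r : ℕ} (G : GMM n r) : Prop where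
  weight_mem : G.weight ∈ stdSimplex ℝ (Fin r)
  cov_posDef : ∀ i, (G.cov i).PosDef

/-- The probability distribution `∑ᵢ pᵢ 𝒩(μᵢ, Σᵢ)`. -/
def GMM.law {n r : ℕ} (G : GMM n r) : Measure (EuclideanSpace ℝ (Fin n)) :=
  ∑ i, ENNReal.ofReal (G.weight i) • multivariateGaussian (G.mean i) (G.cov i)

/-- The density of `𝒩(μ, S)`, for `S` positive definite. -/
def gaussianDensity {n : ℕ} (μ : EuclideanSpace ℝ (Fin n)) (S : Matrix (Fin n) (Fin n) ℝ)
    (x : EuclideanSpace ℝ (Fin n)) : ℝ :=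
  (√((2 * Real.pi) ^ n * S.det))⁻¹ *
    Real.exp (-(1 / 2) * ((x - μ).ofLp ⬝ᵥ (S⁻¹ *ᵥ (x - μ).ofLp)))

/-- `ℓᵢ(x)`: the posterior probability that `x` was drawn from the `i`-th component. -/
def GMM.likelihood {n r : ℕ} (G : GMM n r) (i : Fin r) (x : EuclideanSpace ℝ (Fin n)) : ℝ :=
  G.weight i * gaussianDensity (G.mean i) (G.cov i) x /
    ∑ i', G.weight i' * gaussianDensity (G.mean i') (G.cov i') x

/-- The squared 2-Wasserstein distance between two Gaussians, in closed form. -/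
def gaussianWassersteinSq {n : ℕ} (μx : EuclideanSpace ℝ (Fin n)) (Sx : Matrix (Fin n) (Fin n) ℝ)
    (μy : EuclideanSpace ℝ (Fin n)) (Sy : Matrix (Fin n) (Fin n) ℝ) : ℝ :=
  ‖μx - μy‖ ^ 2 + (Sx + Sy).trace
    - 2 * (CFC.sqrt (CFC.sqrt Sy * Sx * CFC.sqrt Sy)).trace

/-- The transport plans between two finite probability vectors. -/
def transportPlans {a b : ℕ} (p : Fin a → ℝ) (p' : Fin b → ℝ) :
    Set (Matrix (Fin a) (Fin b) ℝ) :=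
  {M | (∀ i j, 0 ≤ M i j) ∧ M *ᵥ 1 = p ∧ Mᵀ *ᵥ 1 = p'}

/-- The GMM-Wasserstein distance: the square root of the optimal value of the discrete optimal
transport problem between the components. -/
def gmmWasserstein {n a b : ℕ} (G : GMM n a) (H : GMM n b) : ℝ :=
  √(sInf ((fun M : Matrix (Fin a) (Fin b) ℝ =>
      ∑ i, ∑ j, gaussianWassersteinSq (G.mean i) (G.cov i) (H.mean j) (H.cov j) * M i j) ''
    transportPlans G.weight H.weight))

/-! ## The controlled linear system and the quadratic cost -/

/-- The system `x_{k+1} = A_k x_k + B_k u_k`, `0 ≤ k < N`. -/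
structure LinearSystem (n m N : ℕ) where
  A : Fin N → Matrix (Fin n) (Fin n) ℝ
  B : Fin N → Matrix (Fin n) (Fin m) ℝ

/-- The data of the cost: input weights `R_0, …, R_{N-1}`, state weights `Q_0, …, Q_N`, and
reference states `x'_0, …, x'_N`. -/
structure QuadraticCost (n m N : ℕ) where
  R : Fin N → Matrix (Fin m) (Fin m) ℝ
  Q : Fin (N + 1) → Matrix (Fin n) (Fin n) ℝ
  ref : Fin (N + 1) → Fin n → ℝ

/-- A control sequence `u_0, …, u_{N-1}` in `ℝᵐ`, stacked in one vector:
the `a`-th coordinate of `u_k` has index `(a, k)`. -/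
abbrev ControlSeq (m N : ℕ) : Type := Fin m × Fin N → ℝ

/-- The state trajectory `x_0, …, x_N` driven by a control sequence. -/
def LinearSystem.trajectory {n m N : ℕ} (sys : LinearSystem n m N) (x₀ : Fin n → ℝ)
    (U : ControlSeq m N) : Fin (N + 1) → Fin n → ℝ :=
  Fin.induction (motive := fun _ => Fin n → ℝ) x₀
    (fun k x => sys.A k *ᵥ x + sys.B k *ᵥ (fun a => U (a, k)))

/-- `‖v‖_S² = vᵀ S v`. -/
def wsq {d : ℕ} (S : Matrix (Fin d) (Fin d) ℝ) (v : Fin d → ℝ) : ℝ := v ⬝ᵥ (S *ᵥ v)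

/-- `J(X, U) = ‖x_N - x'_N‖²_{Q_N} + ∑_{k < N} (‖u_k‖²_{R_k} + ‖x_k - x'_k‖²_{Q_k})`. -/
def QuadraticCost.total {n m N : ℕ} (cost : QuadraticCost n m N)
    (X : Fin (N + 1) → Fin n → ℝ) (U : ControlSeq m N) : ℝ :=
  wsq (cost.Q (Fin.last N)) (X (Fin.last N) - cost.ref (Fin.last N)) +
    ∑ k : Fin N, (wsq (cost.R k) (fun a => U (a, k)) +
      wsq (cost.Q k.castSucc) (X k.castSucc - cost.ref k.castSucc))

/-- The transition matrix `Φ_{k₂,k₁} = A_{k₂-1} ⋯ A_{k₁}` for `k₁ ≤ k₂`, with `Φ_{k,k} = I`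
(the value for `k₁ > k₂` is not used). -/
def LinearSystem.transition {n m N : ℕ} (sys : LinearSystem n m N) (k₂ k₁ : Fin (N + 1)) :
    Matrix (Fin n) (Fin n) ℝ :=
  Fin.induction (motive := fun _ => Matrix (Fin n) (Fin n) ℝ) 1
    (fun k P => if k₁ ≤ k.castSucc then sys.A k * P else 1) k₂

/-- `Φ_{N,0}`. -/
def LinearSystem.PhiN {n m N : ℕ} (sys : LinearSystem n m N) : Matrix (Fin n) (Fin n) ℝ :=
  sys.transition (Fin.last N) 0

/-- The controllability Gramian `∑_{k<N} Φ_{N,k+1} B_k B_kᵀ Φ_{N,k+1}ᵀ`. -/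
def LinearSystem.gramian {n m N : ℕ} (sys : LinearSystem n m N) : Matrix (Fin n) (Fin n) ℝ :=
  ∑ k : Fin N, sys.transition (Fin.last N) k.succ * sys.B k * (sys.B k)ᵀ *
    (sys.transition (Fin.last N) k.succ)ᵀ

/-- `𝐁_N = [Φ_{N,1} B_0, …, Φ_{N,N} B_{N-1}]`. -/
def LinearSystem.BN {n m N : ℕ} (sys : LinearSystem n m N) :
    Matrix (Fin n) (Fin m × Fin N) ℝ :=
  Matrix.of fun a bk => (sys.transition (Fin.last N) bk.2.succ * sys.B bk.2) a bk.1

/-- `𝚪 = [Φ_{0,0}; …; Φ_{N,0}]`. -/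
def LinearSystem.Gam {n m N : ℕ} (sys : LinearSystem n m N) :
    Matrix (Fin n × Fin (N + 1)) (Fin n) ℝ :=
  Matrix.of fun ak b => sys.transition ak.2 0 ak.1 b

/-- `𝐇_u`: the block in position `(k, l)` is `Φ_{k,l+1} B_l` if `l < k`, and `0` otherwise. -/
def LinearSystem.Hu {n m N : ℕ} (sys : LinearSystem n m N) :
    Matrix (Fin n × Fin (N + 1)) (Fin m × Fin N) ℝ :=
  Matrix.of fun ak bl =>
    if bl.2.castSucc < ak.2 then (sys.transition ak.2 bl.2.succ * sys.B bl.2) ak.1 bl.1 else 0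

/-- `𝐑 = bdiag(R_0, …, R_{N-1})`. -/
def QuadraticCost.bigR {n m N : ℕ} (cost : QuadraticCost n m N) :
    Matrix (Fin m × Fin N) (Fin m × Fin N) ℝ :=
  Matrix.blockDiagonal cost.R

/-- `𝐐 = bdiag(Q_0, …, Q_N)`. -/
def QuadraticCost.bigQ {n m N : ℕ} (cost : QuadraticCost n m N) :
    Matrix (Fin n × Fin (N + 1)) (Fin n × Fin (N + 1)) ℝ :=
  Matrix.blockDiagonal cost.Q

/-- `𝐗' = [x'_0; …; x'_N]`. -/
def QuadraticCost.bigRef {n m N : ℕ} (cost : QuadraticCost n m N) :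
    Fin n × Fin (N + 1) → ℝ :=
  fun ak => cost.ref ak.2 ak.1

/-! ## Mean steering and covariance steering of a single Gaussian component -/

section Steering

variable {n m N : ℕ} (sys : LinearSystem n m N) (cost : QuadraticCost n m N)

/-- `J_mean(Ū; μ₀)`. -/
def meanCost (μ₀ : EuclideanSpace ℝ (Fin n)) (U : ControlSeq m N) : ℝ :=
  U ⬝ᵥ (cost.bigR *ᵥ U) +
    (sys.Gam *ᵥ μ₀.ofLp + sys.Hu *ᵥ U - cost.bigRef) ⬝ᵥ
      (cost.bigQ *ᵥ (sys.Gam *ᵥ μ₀.ofLp + sys.Hu *ᵥ U - cost.bigRef))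

/-- The feed-forward sequences that steer the mean from `μ₀` to `μd`. -/
def meanSteeringSet (μ₀ μd : EuclideanSpace ℝ (Fin n)) : Set (ControlSeq m N) :=
  {U | μd.ofLp = sys.PhiN *ᵥ μ₀.ofLp + sys.BN *ᵥ U}

/-- `U` solves the mean steering problem from `μ₀` to `μd`. -/
def IsMeanSteeringSolution (μ₀ μd : EuclideanSpace ℝ (Fin n)) (U : ControlSeq m N) : Prop :=
  U ∈ meanSteeringSet sys μ₀ μd ∧ IsMinOn (meanCost sys cost μ₀) (meanSteeringSet sys μ₀ μd) U

/-- `J_cov(L; Σ₀)`. -/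
def covCost (S₀ : Matrix (Fin n) (Fin n) ℝ) (L : Matrix (Fin m × Fin N) (Fin n) ℝ) : ℝ :=
  (cost.bigR * L * S₀ * Lᵀ).trace +
    (cost.bigQ * (sys.Gam + sys.Hu * L) * S₀ * (sys.Gam + sys.Hu * L)ᵀ).trace

/-- The feedback gains that steer the covariance from `S₀` to `Sd`. -/
def covSteeringSet (S₀ Sd : Matrix (Fin n) (Fin n) ℝ) :
    Set (Matrix (Fin m × Fin N) (Fin n) ℝ) :=
  {L | Sd = (sys.PhiN + sys.BN * L) * S₀ * (sys.PhiN + sys.BN * L)ᵀ}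

/-- `L` solves the covariance steering problem from `S₀` to `Sd`. -/
def IsCovSteeringSolution (S₀ Sd : Matrix (Fin n) (Fin n) ℝ)
    (L : Matrix (Fin m × Fin N) (Fin n) ℝ) : Prop :=
  L ∈ covSteeringSet sys S₀ Sd ∧ IsMinOn (covCost sys cost S₀) (covSteeringSet sys S₀ Sd) L

/-- `M = 𝐑 + 𝐇_uᵀ 𝐐 𝐇_u`. -/
def bigM : Matrix (Fin m × Fin N) (Fin m × Fin N) ℝ :=
  cost.bigR + sys.Huᵀ * cost.bigQ * sys.Hu

/-- The multiplier `Λ⋆ = 2 (𝐁_N M⁻¹ 𝐁_Nᵀ)⁻¹ (𝐁_N M⁻¹ 𝐇_uᵀ 𝐐 Y + (μd - Φ_{N,0} μ₀))`, where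
`Y = 𝚪 μ₀ - 𝐗'`. -/
def meanMultiplier (μ₀ μd : EuclideanSpace ℝ (Fin n)) : Fin n → ℝ :=
  (2 : ℝ) • ((sys.BN * (bigM sys cost)⁻¹ * sys.BNᵀ)⁻¹ *ᵥ
    ((sys.BN * (bigM sys cost)⁻¹ * sys.Huᵀ * cost.bigQ) *ᵥ (sys.Gam *ᵥ μ₀.ofLp - cost.bigRef) +
      (μd.ofLp - sys.PhiN *ᵥ μ₀.ofLp)))

/-- `Ū⋆ = (1/2) M⁻¹ (𝐁_Nᵀ Λ⋆ - 2 𝐇_uᵀ 𝐐 Y)`. -/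
def meanControl (μ₀ μd : EuclideanSpace ℝ (Fin n)) : ControlSeq m N :=
  (1 / 2 : ℝ) • ((bigM sys cost)⁻¹ *ᵥ (sys.BNᵀ *ᵥ meanMultiplier sys cost μ₀ μd -
    (2 : ℝ) • ((sys.Huᵀ * cost.bigQ) *ᵥ (sys.Gam *ᵥ μ₀.ofLp - cost.bigRef))))

/-- `J⋆_mean(μ₀, μd) = J_mean(Ū⋆; μ₀)`, a quadratic function of `(μ₀, μd)`. -/
def meanCostOpt (μ₀ μd : EuclideanSpace ℝ (Fin n)) : ℝ :=
  meanCost sys cost μ₀ (meanControl sys cost μ₀ μd)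

variable {d : ℕ} (D : Matrix (Fin m × Fin N) (Fin d) ℝ)

/-- `Θ₁ = I - D (Dᵀ M D)⁻¹ Dᵀ M`. -/
def Theta1 : Matrix (Fin m × Fin N) (Fin m × Fin N) ℝ :=
  1 - D * (Dᵀ * bigM sys cost * D)⁻¹ * Dᵀ * bigM sys cost

/-- `Θ₂ = D (Dᵀ M D)⁻¹ Dᵀ 𝐇_uᵀ 𝐐 𝚪`. -/
def Theta2 : Matrix (Fin m × Fin N) (Fin n) ℝ :=
  D * (Dᵀ * bigM sys cost * D)⁻¹ * Dᵀ * sys.Huᵀ * cost.bigQ * sys.Gam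

/-- `Θ₃ = 𝐁_Nᵀ 𝒢⁻¹ Φ_{N,0}`. -/
def Theta3 : Matrix (Fin m × Fin N) (Fin n) ℝ :=
  sys.BNᵀ * sys.gramian⁻¹ * sys.PhiN

/-- `Θ₄ = Θ₁ Θ₃ + Θ₂`. -/
def Theta4 : Matrix (Fin m × Fin N) (Fin n) ℝ :=
  Theta1 sys cost D * Theta3 sys + Theta2 sys cost D

/-- `Θ₅ = 𝚪 - 𝐇_u Θ₄`. -/
def Theta5 : Matrix (Fin n × Fin (N + 1)) (Fin n) ℝ :=
  sys.Gam - sys.Hu * Theta4 sys cost D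

/-- `Θ₆ = 𝒢⁻¹ 𝐁_N Θ₁ᵀ M Θ₁ 𝐁_Nᵀ 𝒢⁻ᵀ`. -/
def Theta6 : Matrix (Fin n) (Fin n) ℝ :=
  sys.gramian⁻¹ * sys.BN * (Theta1 sys cost D)ᵀ * bigM sys cost * Theta1 sys cost D *
    sys.BNᵀ * (sys.gramian⁻¹)ᵀ

/-- `Θ₇ = Θ₄ᵀ 𝐑 Θ₄ + Θ₅ᵀ 𝐐 Θ₅`. -/
def Theta7 : Matrix (Fin n) (Fin n) ℝ :=
  (Theta4 sys cost D)ᵀ * cost.bigR * Theta4 sys cost D +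
    (Theta5 sys cost D)ᵀ * cost.bigQ * Theta5 sys cost D

/-- `Θ₈ = (Θ₅ᵀ 𝐐 𝐇_u - Θ₄ᵀ 𝐑) Θ₁ 𝐁_Nᵀ 𝒢⁻¹`. -/
def Theta8 : Matrix (Fin n) (Fin n) ℝ :=
  ((Theta5 sys cost D)ᵀ * cost.bigQ * sys.Hu - (Theta4 sys cost D)ᵀ * cost.bigR) *
    Theta1 sys cost D * sys.BNᵀ * sys.gramian⁻¹

end Steering

/-! ## The randomized policies and the density steering problem over them -/

/-- The parameters of a policy: mixing weights `λ_{ij}`, stacked feedback gains `𝐋_{ij}` and stacked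
feed-forward inputs `𝐔̄_{ij}`. -/
structure PolicyParams (n m N r q : ℕ) where
  weight : Matrix (Fin r) (Fin q) ℝ
  gain : Fin r → Fin q → Matrix (Fin m × Fin N) (Fin n) ℝ
  feedforward : Fin r → Fin q → ControlSeq m N

/-- Every row of the mixing weights is a probability vector. -/
def PolicyParams.IsAdmissible {n m N r q : ℕ} (pol : PolicyParams n m N r q) : Prop :=
  ∀ i, pol.weight i ∈ stdSimplex ℝ (Fin q)

lemma measurable_likelihood {n r : ℕ} (G : GMM n r) (i : Fin r) :
    Measurable (G.likelihood i) := by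
  have h : ∀ i', Measurable (gaussianDensity (G.mean i') (G.cov i')) := by
    intro i'
    apply Continuous.measurable
    unfold gaussianDensity
    simp only [dotProduct, Matrix.mulVec]
    fun_prop
  unfold GMM.likelihood
  fun_prop

/-- The randomized policy: given the initial state `x₀`, the whole control sequence is
`𝐋_{ij} (x₀ - μᵢ⁰) + 𝐔̄_{ij}` with probability `γ_{ij}(x₀) = λ_{ij} ℓᵢ(x₀)`. -/
def PolicyParams.kernel {n m N r q : ℕ} (pol : PolicyParams n m N r q) (init : GMM n r) :
    Kernel (EuclideanSpace ℝ (Fin n)) (ControlSeq m N) where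
  toFun x := ∑ i, ∑ j, ENNReal.ofReal (pol.weight i j * init.likelihood i x) •
    Measure.dirac (pol.gain i j *ᵥ (x - init.mean i).ofLp + pol.feedforward i j)
  measurable' := by
    apply Measure.measurable_of_measurable_coe
    intro s hs
    simp only [Measure.coe_finsetSum, Finset.sum_apply, Measure.smul_apply, smul_eq_mul]
    refine Finset.measurable_sum _ fun i _ => Finset.measurable_sum _ fun j _ => ?_
    refine Measurable.mul ?_ ?_
    · exact ((measurable_likelihood init i).const_mul _).ennreal_ofReal
    · have h : Continuous fun x : EuclideanSpace ℝ (Fin n) =>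
          pol.gain i j *ᵥ (x - init.mean i).ofLp + pol.feedforward i j := by
        fun_prop
      exact (Measure.measurable_coe hs).comp (Measure.measurable_dirac.comp h.measurable)

/-- The joint law of the initial state `x₀ ∼ init` and the random control sequence. -/
def PolicyParams.jointLaw {n m N r q : ℕ} (pol : PolicyParams n m N r q) (init : GMM n r) :
    Measure (EuclideanSpace ℝ (Fin n) × ControlSeq m N) :=
  init.law ⊗ₘ pol.kernel init

/-- The law of the terminal state `x_N`. -/
def PolicyParams.terminalLaw {n m N r q : ℕ} (pol : PolicyParams n m N r q)
    (sys : LinearSystem n m N) (init : GMM n r) : Measure (EuclideanSpace ℝ (Fin n)) :=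
  (pol.jointLaw init).map
    (fun z => WithLp.toLp 2 (sys.trajectory z.1.ofLp z.2 (Fin.last N)))

/-- The random cost `J(X_{0:N}, U_{0:N-1})` as a function of `x₀` and the control sequence. -/
def realizedCost {n m N : ℕ} (sys : LinearSystem n m N) (cost : QuadraticCost n m N)
    (z : EuclideanSpace ℝ (Fin n) × ControlSeq m N) : ℝ :=
  cost.total (sys.trajectory z.1.ofLp z.2) z.2

section Problems

variable {n m N r q t : ℕ} (sys : LinearSystem n m N) (cost : QuadraticCost n m N)
  (init : GMM n r) (target : GMM n t) (κ : ℝ)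

/-- `pol` is an admissible policy under which `x_N` is distributed as the Gaussian mixture `G` with
`q` components, and whose expected total cost is at most `κ`. -/
structure SteeringFeasible (pol : PolicyParams n m N r q) (G : GMM n q) : Prop where
  admissible : pol.IsAdmissible
  terminal_valid : G.IsValid
  terminal_law : pol.terminalLaw sys init = G.law
  cost_integrable : Integrable (realizedCost sys cost) (pol.jointLaw init)
  cost_le : ∫ z, realizedCost sys cost z ∂(pol.jointLaw init) ≤ κ

/-- `pol`, with terminal mixture `G`, solves the total-cost-constrained density steering problem:
it minimizes the squared GMM-Wasserstein distance of the terminal mixture to the target. -/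
def SteeringOptimal (pol : PolicyParams n m N r q) (G : GMM n q) : Prop :=
  SteeringFeasible sys cost init κ pol G ∧
    ∀ (pol' : PolicyParams n m N r q) (G' : GMM n q), SteeringFeasible sys cost init κ pol' G' →
      gmmWasserstein G target ^ 2 ≤ gmmWasserstein G' target ^ 2

/-- The objective values that feasible policies attain. -/
def steeringValues (q : ℕ) : Set ℝ :=
  {v | ∃ (pol : PolicyParams n m N r q) (G : GMM n q),
    SteeringFeasible sys cost init κ pol G ∧ v = gmmWasserstein G target ^ 2}

/-! ## The bilinear program -/

/-- The decision variables of the bilinear program. The field `terminal` holds the weights `𝐩_N`,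
the means `μ_jᴺ` and the covariances `Σ_jᴺ`. -/
structure BilinearVars (n r q t : ℕ) where
  lam : Matrix (Fin r) (Fin q) ℝ
  C : Matrix (Fin r) (Fin q) ℝ
  beta : Matrix (Fin q) (Fin t) ℝ
  T : Matrix (Fin q) (Fin t) ℝ
  L : Fin r → Fin q → Matrix (Fin n) (Fin n) ℝ
  Y : Fin q → Fin t → Matrix (Fin n) (Fin n) ℝ
  terminal : GMM n q

/-- `tr(𝐓ᵀ 𝛃)`. -/
def BilinearVars.objective (s : BilinearVars n r q t) : ℝ := (s.Tᵀ * s.beta).trace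

/-- The constraints of the bilinear program. -/
structure BilinearFeasible {d : ℕ} (D : Matrix (Fin m × Fin N) (Fin d) ℝ)
    (s : BilinearVars n r q t) : Prop where
  lam_row : s.lam *ᵥ 1 = init.weight
  lam_col : s.lamᵀ *ᵥ 1 = s.terminal.weight
  lam_nonneg : ∀ i j, 0 ≤ s.lam i j
  beta_row : s.beta *ᵥ 1 = s.terminal.weight
  beta_col : s.betaᵀ *ᵥ 1 = target.weight
  beta_nonneg : ∀ i j, 0 ≤ s.beta i j
  C_ge : ∀ i j, meanCostOpt sys cost (init.mean i) (s.terminal.mean j) +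
    (Theta6 sys cost D * s.terminal.cov j).trace + (Theta7 sys cost D * init.cov i).trace +
    (s.L i j + (s.L i j)ᵀ).trace ≤ s.C i j
  L_block : ∀ i j, (Matrix.fromBlocks
    (Theta8 sys cost D * s.terminal.cov j * (Theta8 sys cost D)ᵀ) (s.L i j)
    (s.L i j)ᵀ (init.cov i)).PosSemidef
  T_ge : ∀ i j, ‖target.mean j - s.terminal.mean i‖ ^ 2 + (s.terminal.cov i).trace +
    (target.cov j).trace + (s.Y i j + (s.Y i j)ᵀ).trace ≤ s.T i j
  Y_block : ∀ i j, (Matrix.fromBlocks (s.terminal.cov i) (s.Y i j)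
    (s.Y i j)ᵀ (target.cov j)).PosSemidef
  cost_le : (s.Cᵀ * s.lam).trace ≤ κ

/-- `s` is a global minimizer of the bilinear program. -/
def BilinearOptimal {d : ℕ} (D : Matrix (Fin m × Fin N) (Fin d) ℝ)
    (s : BilinearVars n r q t) : Prop :=
  BilinearFeasible sys cost init target κ D s ∧
    ∀ s' : BilinearVars n r q t, BilinearFeasible sys cost init target κ D s' →
      s.objective ≤ s'.objective

/-- The objective values that feasible points of the bilinear program attain. -/
def bilinearValues (q : ℕ) {d : ℕ} (D : Matrix (Fin m × Fin N) (Fin d) ℝ) : Set ℝ :=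
  {v | ∃ s : BilinearVars n r q t,
    BilinearFeasible sys cost init target κ D s ∧ v = s.objective}

/-- The policies that a point of the bilinear program determines: the mixing weights are
`λ_{ij} = λ̃_{ij} / p_i⁰` (a row with `p_i⁰ = 0` is an arbitrary probability vector), and
`𝐔̄_{ij}`, `𝐋_{ij}` solve the mean and the covariance steering problem from
`(μ_i⁰, Σ_i⁰)` to `(μ_jᴺ, Σ_jᴺ)`. -/
structure IsRecoveredPolicy (s : BilinearVars n r q t) (pol : PolicyParams n m N r q) : Prop where
  admissible : pol.IsAdmissible
  weight_eq : ∀ i j, init.weight i ≠ 0 → pol.weight i j = s.lam i j / init.weight i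
  feedforward_opt : ∀ i j, IsMeanSteeringSolution sys cost (init.mean i) (s.terminal.mean j)
    (pol.feedforward i j)
  gain_opt : ∀ i j, IsCovSteeringSolution sys cost (init.cov i) (s.terminal.cov j) (pol.gain i j)

end Problems

end GMMSteering

end

open GMMSteering

noncomputable section

namespace GMMSteering

/-! ## Positive semidefinite matrices -/

section Matrices

set_option linter.unusedSectionVars false

variable {ι κ : Type*} [Fintype ι] [DecidableEq ι] [Fintype κ] [DecidableEq κ]

/-! Along branch `(i, j)` of a policy the terminal state is an affine image of the `i`-th initial
component, hence Gaussian with covariance `K Σᵢ⁰ Kᵀ`, where `K = Φ + 𝐁 𝐋ᵢⱼ`. Multiplying the initial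
mixture by the posterior `ℓᵢ` gives back its `i`-th component. So the joint law is the mixture of
the branches with weights `pᵢ⁰ λᵢⱼ` (`jointLaw_eq_sum`), and the expected cost is the same mixture
of mean costs plus covariance costs (`integral_realizedCost`). What remains is to solve the steering
problem of one branch and to match branches with terminal components.

One branch. Mean steering is an equality-constrained strictly convex quadratic program, solved by
its multiplier. For covariance steering, fix the closed loop `K`. The gains with this `K` differ by
columns in `ker 𝐁 = range D`, and the best of them, `gainOf`, costs `tr(Θ₆ K Σ₀ Kᵀ) + tr(Θ₇ Σ₀) + 2
tr(Θ₈ K Σ₀)`. Once `K Σ₀ Kᵀ = Σ₁` is imposed, only the last trace varies. The matrix `X = Θ₈ K Σ₀`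
satisfies the semidefinite block constraint, and the relaxation loses nothing: both minima of `tr X`
equal `-tr((Σ₀^{1/2} Θ₈ Σ₁ Θ₈ᵀ Σ₀^{1/2})^{1/2})`. The lower bound is
`neg_trace_sqrt_le_of_fromBlocks` (Schur complement), and a polar decomposition attains it
(`exists_gain_trace_eq`). With the identity in place of `Θ₈`, the same two lemmas turn the
Wasserstein formula into the semidefinite constraint on `Y`.

Matching. A feasible policy need not send branch `(i, j)` to the `j`-th component of its terminal
mixture; only the laws agree. Finite Gaussian mixtures are identifiable
(`fiber_weight_eq_of_mixture_eq`), so every pair (mean, covariance) carries the same total weight on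
both sides. `exists_coupling` therefore redistributes the branch weights over terminal components
with equal parameters, keeping the marginals and not raising the cost. This yields a point of (B).
Conversely, in a recovered policy all branches with the same `j` end in the same Gaussian, so they
merge into the `j`-th component, and the constraints of (B) bound the cost and the distance. -/

lemma posSemidef_mul_mul_transpose {A : Matrix ι ι ℝ} (hA : A.PosSemidef) (B : Matrix κ ι ℝ) :
    (B * A * Bᵀ).PosSemidef := by
  simpa [conjTranspose_eq_transpose_of_trivial] using hA.mul_mul_conjTranspose_same B

lemma posSemidef_transpose_mul_mul {A : Matrix ι ι ℝ} (hA : A.PosSemidef) (B : Matrix ι κ ℝ) :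
    (Bᵀ * A * B).PosSemidef := by
  simpa [conjTranspose_eq_transpose_of_trivial] using hA.conjTranspose_mul_mul_same B

lemma posSemidef_mul_transpose_self (B : Matrix κ ι ℝ) : (B * Bᵀ).PosSemidef := by
  simpa using posSemidef_mul_mul_transpose PosSemidef.one B

lemma transpose_eq_of_posSemidef {A : Matrix ι ι ℝ} (hA : A.PosSemidef) : Aᵀ = A := by
  simpa [IsHermitian, conjTranspose_eq_transpose_of_trivial] using hA.1

lemma dotProduct_mulVec_self_nonneg {A : Matrix ι ι ℝ} (hA : A.PosSemidef) (v : ι → ℝ) :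
    0 ≤ v ⬝ᵥ (A *ᵥ v) := by
  simpa using hA.dotProduct_mulVec_nonneg v

lemma posSemidef_of_dotProduct {A : Matrix ι ι ℝ} (hA : Aᵀ = A)
    (h : ∀ v, 0 ≤ v ⬝ᵥ (A *ᵥ v)) : A.PosSemidef :=
  PosSemidef.of_dotProduct_mulVec_nonneg
    (by simpa [IsHermitian, conjTranspose_eq_transpose_of_trivial] using hA) (by simpa using h)

lemma sqrt_posSemidef (A : Matrix ι ι ℝ) : (CFC.sqrt A).PosSemidef :=
  nonneg_iff_posSemidef.1 (CFC.sqrt_nonneg A)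

lemma sqrt_transpose (A : Matrix ι ι ℝ) : (CFC.sqrt A)ᵀ = CFC.sqrt A :=
  transpose_eq_of_posSemidef (sqrt_posSemidef A)

lemma sqrt_mul_self {A : Matrix ι ι ℝ} (hA : A.PosSemidef) : CFC.sqrt A * CFC.sqrt A = A :=
  CFC.sqrt_mul_sqrt_self A hA.nonneg

lemma sqrt_eq_of_mul_self {A P : Matrix ι ι ℝ} (hP : P.PosSemidef) (h : P * P = A) :
    CFC.sqrt A = P :=
  CFC.sqrt_unique h hP.nonneg

lemma sqrt_mul_inv {A : Matrix ι ι ℝ} (hA : A.PosDef) : CFC.sqrt A * (CFC.sqrt A)⁻¹ = 1 := by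
  have h : IsUnit (CFC.sqrt A).det := by
    have h1 : IsUnit A.det := (isUnit_iff_isUnit_det _).1 hA.isUnit
    rw [← sqrt_mul_self hA.posSemidef, det_mul] at h1
    exact (IsUnit.mul_iff.1 h1).1
  exact mul_nonsing_inv _ h

lemma sqrt_inv_mul {A : Matrix ι ι ℝ} (hA : A.PosDef) : (CFC.sqrt A)⁻¹ * CFC.sqrt A = 1 :=
  mul_eq_one_comm.1 (sqrt_mul_inv hA)

lemma trace_mul_nonneg {A B : Matrix ι ι ℝ} (hA : A.PosSemidef) (hB : B.PosSemidef) :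
    0 ≤ (A * B).trace := by
  rw [← sqrt_mul_self hB, ← mul_assoc, trace_mul_comm, ← mul_assoc]
  have := posSemidef_mul_mul_transpose hA (CFC.sqrt B)
  rw [sqrt_transpose] at this
  exact this.trace_nonneg

/-- If `Z Zᵀ ≤ P²` with `P` positive semidefinite, then `tr Z ≥ - tr P`. -/
lemma neg_trace_le_of_mul_transpose_le {P Z : Matrix ι ι ℝ} (hP : P.PosSemidef)
    (h : (P * P - Z * Zᵀ).PosSemidef) : -P.trace ≤ Z.trace := by
  set U : Matrix ι ι ℝ := (hP.1.eigenvectorUnitary : Matrix ι ι ℝ) with hU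
  set d := hP.1.eigenvalues
  have hUU : Uᵀ * U = 1 := by
    have := Unitary.coe_star_mul_self hP.1.eigenvectorUnitary
    simpa [star_eq_conjTranspose, conjTranspose_eq_transpose_of_trivial] using this
  have hUU' : U * Uᵀ = 1 := mul_eq_one_comm.1 hUU
  have hPd : P = U * diagonal d * Uᵀ := by
    have := hP.1.spectral_theorem
    simpa [Unitary.conjStarAlgAut_apply, star_eq_conjTranspose,
      conjTranspose_eq_transpose_of_trivial] using this
  have hd : ∀ i, 0 ≤ d i := hP.eigenvalues_nonneg
  set Z' := Uᵀ * Z * U with hZ'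
  have htr : ∀ A : Matrix ι ι ℝ, (Uᵀ * A * U).trace = A.trace := by
    intro A
    rw [trace_mul_comm, ← mul_assoc, hUU', one_mul]
  have hUP : Uᵀ * P * U = diagonal d := by
    rw [hPd]
    calc Uᵀ * (U * diagonal d * Uᵀ) * U = (Uᵀ * U) * diagonal d * (Uᵀ * U) := by
          simp only [mul_assoc]
      _ = _ := by simp [hUU]
  have hconj : Uᵀ * (P * P - Z * Zᵀ) * U = diagonal d * diagonal d - Z' * Z'ᵀ := by
    rw [← hUP, hZ']
    simp only [transpose_mul, transpose_transpose, Matrix.mul_sub, Matrix.sub_mul]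
    congr 1
    · calc Uᵀ * (P * P) * U = Uᵀ * P * 1 * P * U := by simp only [mul_assoc, one_mul]
        _ = _ := by rw [← hUU']; simp only [mul_assoc]
    · calc Uᵀ * (Z * Zᵀ) * U = Uᵀ * Z * 1 * Zᵀ * U := by simp only [mul_assoc, one_mul]
        _ = _ := by rw [← hUU']; simp only [mul_assoc]
  have hpsd := posSemidef_transpose_mul_mul h U
  rw [hconj] at hpsd
  -- In an eigenbasis of `P`, the diagonal of `Z Zᵀ ≤ P²` reads `∑ⱼ Z'ᵢⱼ² ≤ dᵢ²`, which bounds each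
  -- diagonal entry of `Z'` by `dᵢ` in absolute value.
  have hle : ∀ i, -d i ≤ Z' i i := by
    intro i
    have h1 := hpsd.diag_nonneg (i := i)
    simp only [diagonal_mul_diagonal, Matrix.sub_apply, diagonal_apply_eq, mul_apply,
      transpose_apply] at h1
    have h2 : Z' i i * Z' i i ≤ ∑ j, Z' i j * Z' i j :=
      Finset.single_le_sum (f := fun j => Z' i j * Z' i j) (fun j _ => mul_self_nonneg _)
        (Finset.mem_univ i)
    nlinarith [hd i]
  calc -P.trace = ∑ i, -d i := by
        rw [← htr P, hUP]; simp [trace]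
    _ ≤ ∑ i, Z' i i := Finset.sum_le_sum fun i _ => hle i
    _ = Z.trace := by rw [← htr Z]; rfl

lemma isCompact_mul_transpose_eq_one : IsCompact {V : Matrix ι ι ℝ | V * Vᵀ = 1} := by
  have hcl : IsClosed {V : Matrix ι ι ℝ | V * Vᵀ = 1} :=
    isClosed_eq (by fun_prop) continuous_const
  have hK : IsCompact (Set.univ.pi fun _ : ι => Set.univ.pi fun _ : ι => Set.Icc (-1 : ℝ) 1) :=
    isCompact_univ_pi fun _ => isCompact_univ_pi fun _ => isCompact_Icc
  refine hK.of_isClosed_subset hcl ?_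
  intro (V : Matrix ι ι ℝ) (hV : V * Vᵀ = 1) i _ j _
  have h1 : (V * Vᵀ) i i = 1 := by rw [hV]; simp
  simp only [mul_apply, transpose_apply] at h1
  have h2 : V i j * V i j ≤ ∑ k, V i k * V i k :=
    Finset.single_le_sum (f := fun k => V i k * V i k) (fun k _ => mul_self_nonneg _)
      (Finset.mem_univ j)
  constructor <;> nlinarith

lemma isClosed_posSemidef : IsClosed {A : Matrix ι ι ℝ | A.PosSemidef} := by
  have : {A : Matrix ι ι ℝ | A.PosSemidef} =
      {A | Aᵀ = A} ∩ ⋂ v : ι → ℝ, {A | 0 ≤ v ⬝ᵥ (A *ᵥ v)} := by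
    ext A
    simp only [Set.mem_ofPred_eq, Set.mem_inter_iff, Set.mem_iInter]
    exact ⟨fun h => ⟨transpose_eq_of_posSemidef h, dotProduct_mulVec_self_nonneg h⟩,
      fun h => posSemidef_of_dotProduct h.1 h.2⟩
  rw [this]
  refine (isClosed_eq (by fun_prop) (by fun_prop)).inter (isClosed_iInter fun v => ?_)
  exact isClosed_le continuous_const (by fun_prop)

/-- Polar decomposition with an orthogonal factor, also for singular matrices. -/
lemma exists_orthogonal_mul_posSemidef (A : Matrix ι ι ℝ) :
    ∃ V : Matrix ι ι ℝ, V * Vᵀ = 1 ∧ (A * V).PosSemidef := by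
  have hinv : ∀ B : Matrix ι ι ℝ, IsUnit B → ∃ V ∈ {V : Matrix ι ι ℝ | V * Vᵀ = 1},
      (B * V).PosSemidef := by
    intro B hB
    have hdet := (isUnit_iff_isUnit_det _).1 hB
    refine ⟨B⁻¹ * CFC.sqrt (B * Bᵀ), ?_, ?_⟩
    · have h := sqrt_mul_self (posSemidef_mul_transpose_self B)
      calc B⁻¹ * CFC.sqrt (B * Bᵀ) * (B⁻¹ * CFC.sqrt (B * Bᵀ))ᵀ
          = B⁻¹ * (CFC.sqrt (B * Bᵀ) * CFC.sqrt (B * Bᵀ)) * (B⁻¹)ᵀ := by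
            rw [transpose_mul, sqrt_transpose]; simp only [mul_assoc]
        _ = (B⁻¹ * B) * (B⁻¹ * B)ᵀ := by rw [h, transpose_mul]; simp only [mul_assoc]
        _ = 1 := by simp [nonsing_inv_mul _ hdet]
    · rw [← mul_assoc, mul_nonsing_inv _ hdet, one_mul]
      exact sqrt_posSemidef _
  -- A singular `A` is approximated by `A + ε`, invertible for all small `ε > 0` because the
  -- spectrum is finite. The orthogonal factors subconverge by compactness, and positive
  -- semidefiniteness survives the limit.
  have hfin : (spectrum ℝ (-A)).Finite := Matrix.finite_spectrum _
  obtain ⟨N, hN⟩ : ∃ N : ℕ, ∀ k : ℕ, N ≤ k → IsUnit (A + (1 / ((k : ℝ) + 1)) • 1) := by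
    have h1 : ∀ᶠ k : ℕ in Filter.atTop, (1 / ((k : ℝ) + 1)) ∉ spectrum ℝ (-A) := by
      have hinj : Function.Injective fun k : ℕ => (1 / ((k : ℝ) + 1)) := by
        intro a b hab
        simp only [one_div, _root_.inv_inj] at hab
        exact_mod_cast (add_right_cancel hab)
      have := (hfin.preimage hinj.injOn).eventually_cofinite_notMem
      rw [Nat.cofinite_eq_atTop] at this
      exact this
    obtain ⟨N, hN⟩ := Filter.eventually_atTop.1 h1
    refine ⟨N, fun k hk => ?_⟩
    have := hN k hk
    rw [spectrum.notMem_iff] at this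
    rw [Algebra.algebraMap_eq_smul_one, sub_neg_eq_add, add_comm] at this
    exact this
  choose V hV hVA using fun k : ℕ => hinv _ (hN (N + k) (Nat.le_add_right _ _))
  have : FirstCountableTopology (Matrix ι ι ℝ) :=
    inferInstanceAs (FirstCountableTopology (ι → ι → ℝ))
  obtain ⟨W, hW, φ, hφ, hlim⟩ := isCompact_mul_transpose_eq_one.tendsto_subseq hV
  refine ⟨W, hW, ?_⟩
  have he : Filter.Tendsto (fun k : ℕ => (1 / (((N + φ k : ℕ) : ℝ) + 1))) Filter.atTop (nhds 0) :=
    tendsto_one_div_add_atTop_nhds_zero_nat.comp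
      (Filter.tendsto_atTop_mono (fun k => (Nat.le_add_left _ _)) hφ.tendsto_atTop)
  have hlim2 : Filter.Tendsto
      (fun k : ℕ => (A + (1 / (((N + φ k : ℕ) : ℝ) + 1)) • (1 : Matrix ι ι ℝ)) * V (φ k))
      Filter.atTop (nhds (A * W)) := by
    have h2 := (tendsto_const_nhds (x := A)).add (he.smul_const (1 : Matrix ι ι ℝ))
    rw [zero_smul, add_zero] at h2
    exact h2.mul hlim
  exact isClosed_posSemidef.mem_of_tendsto hlim2 (Filter.Eventually.of_forall fun k => hVA (φ k))

/-- Lower bound for the trace of an off-diagonal block of a positive semidefinite matrix. -/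
lemma neg_trace_sqrt_le_of_fromBlocks {S F X : Matrix ι ι ℝ} (hS : S.PosDef) (hF : F.PosSemidef)
    (h : (fromBlocks F X Xᵀ S).PosSemidef) :
    -(CFC.sqrt (CFC.sqrt S * F * CFC.sqrt S)).trace ≤ X.trace := by
  set s := CFC.sqrt S with hs
  have hsT : sᵀ = s := sqrt_transpose S
  have hss : s * s = S := sqrt_mul_self hS.posSemidef
  have hsi : s * s⁻¹ = 1 := sqrt_mul_inv hS
  have his : s⁻¹ * s = 1 := sqrt_inv_mul hS
  have hsiT : (s⁻¹)ᵀ = s⁻¹ := by rw [transpose_nonsing_inv, hsT]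
  have := hS.isUnit.invertible
  -- Conjugating the Schur complement by `s = S^{1/2}` turns it into `Z Zᵀ ≤ s F s` with `Z = s X
  -- s⁻¹`, a matrix with the same trace as `X`.
  have h1 : (F - X * S⁻¹ * Xᵀ).PosSemidef := by
    have := (PosDef.fromBlocks₂₂ F X hS).1
      (by simpa [conjTranspose_eq_transpose_of_trivial] using h)
    simpa [conjTranspose_eq_transpose_of_trivial] using this
  have hSi : S⁻¹ = s⁻¹ * s⁻¹ := by rw [← hss, Matrix.mul_inv_rev]
  have hsF : (s * F * s).PosSemidef := by
    simpa [hsT] using posSemidef_mul_mul_transpose hF s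
  have h2 := posSemidef_mul_mul_transpose h1 s
  have h3 : s * (F - X * S⁻¹ * Xᵀ) * sᵀ = CFC.sqrt (s * F * s) * CFC.sqrt (s * F * s) -
      (s * X * s⁻¹) * (s * X * s⁻¹)ᵀ := by
    rw [sqrt_mul_self hsF, hsT, hSi]
    simp only [transpose_mul, hsT, hsiT, Matrix.mul_sub, Matrix.sub_mul, mul_assoc]
  rw [h3] at h2
  have h4 := neg_trace_le_of_mul_transpose_le (sqrt_posSemidef _) h2
  rwa [trace_mul_comm, ← mul_assoc, his, one_mul] at h4

/-- The block matrix factors as `[ΘK; 1] S [ΘK; 1]ᵀ`. Thus each closed loop `K` gives a feasible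
point of the semidefinite relaxation. -/
lemma fromBlocks_posSemidef_of_gain {S : Matrix ι ι ℝ} (hS : S.PosSemidef) (Θ K : Matrix ι ι ℝ) :
    (fromBlocks (Θ * (K * S * Kᵀ) * Θᵀ) (Θ * K * S) (Θ * K * S)ᵀ S).PosSemidef := by
  have h := posSemidef_mul_mul_transpose hS (fromRows (Θ * K) (1 : Matrix ι ι ℝ))
  convert h using 1
  rw [fromRows_mul, transpose_fromRows, fromRows_mul_fromCols]
  simp [transpose_mul, mul_assoc, transpose_eq_of_posSemidef hS]

/-- The lower bound of `neg_trace_sqrt_le_of_fromBlocks` is attained at a gain that transports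
`S₀` to `S₁`. -/
lemma exists_gain_trace_eq {S₀ S₁ : Matrix ι ι ℝ} (h₀ : S₀.PosDef) (h₁ : S₁.PosSemidef)
    (Θ : Matrix ι ι ℝ) :
    ∃ K : Matrix ι ι ℝ, K * S₀ * Kᵀ = S₁ ∧
      (Θ * K * S₀).trace = -(CFC.sqrt (CFC.sqrt S₀ * (Θ * S₁ * Θᵀ) * CFC.sqrt S₀)).trace := by
  set s := CFC.sqrt S₀ with hs
  set w := CFC.sqrt S₁ with hw
  have hsT : sᵀ = s := sqrt_transpose S₀
  have hwT : wᵀ = w := sqrt_transpose S₁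
  have hss : s * s = S₀ := sqrt_mul_self h₀.posSemidef
  have hww : w * w = S₁ := sqrt_mul_self h₁
  have hsi : s * s⁻¹ = 1 := sqrt_mul_inv h₀
  have his : s⁻¹ * s = 1 := sqrt_inv_mul h₀
  have hsiT : (s⁻¹)ᵀ = s⁻¹ := by rw [transpose_nonsing_inv, hsT]
  -- Every `K = -(w V s⁻¹)` with `V` orthogonal transports `S₀` to `S₁`, and then `tr(Θ K S₀) =
  -- -tr(s Θ w V)`. The polar factor makes `s Θ w V` the square root of `s Θ S₁ Θᵀ s`.
  obtain ⟨V, hV, hP⟩ := exists_orthogonal_mul_posSemidef (s * Θ * w)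
  have hsq : CFC.sqrt (s * (Θ * S₁ * Θᵀ) * s) = s * Θ * w * V := by
    refine sqrt_eq_of_mul_self hP ?_
    nth_rewrite 2 [← transpose_eq_of_posSemidef hP]
    calc s * Θ * w * V * (s * Θ * w * V)ᵀ = s * Θ * w * (V * Vᵀ) * (w * Θᵀ * s) := by
          simp only [transpose_mul, hsT, hwT, mul_assoc]
      _ = s * (Θ * (w * w) * Θᵀ) * s := by rw [hV]; simp only [mul_assoc, one_mul]
      _ = _ := by rw [hww]
  refine ⟨-(w * V * s⁻¹), ?_, ?_⟩
  · calc -(w * V * s⁻¹) * S₀ * (-(w * V * s⁻¹))ᵀ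
        = w * V * (s⁻¹ * s) * (s * s⁻¹) * Vᵀ * w := by
          rw [← hss]
          simp only [transpose_neg, transpose_mul, hsiT, hwT, Matrix.neg_mul, Matrix.mul_neg,
            neg_neg, mul_assoc]
      _ = w * (V * Vᵀ) * w := by rw [his, hsi]; simp only [mul_assoc, one_mul]
      _ = S₁ := by rw [hV, mul_one, hww]
  · rw [hsq]
    calc (Θ * -(w * V * s⁻¹) * S₀).trace = -(Θ * w * V * (s⁻¹ * s) * s).trace := by
          rw [← hss]
          simp only [Matrix.neg_mul, Matrix.mul_neg, trace_neg, mul_assoc]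
      _ = -(s * (Θ * w * V)).trace := by rw [his, mul_one, trace_mul_comm]
      _ = _ := by simp only [mul_assoc]

end Matrices

/-! ## The closed-form Wasserstein distance between Gaussians -/

section Wasserstein

variable {n : ℕ} (μx μy : EuclideanSpace ℝ (Fin n)) {Sx Sy : Matrix (Fin n) (Fin n) ℝ}

lemma gaussianWassersteinSq_le_of_fromBlocks (hx : Sx.PosSemidef) (hy : Sy.PosDef)
    {Y : Matrix (Fin n) (Fin n) ℝ} (hY : (fromBlocks Sx Y Yᵀ Sy).PosSemidef) :
    gaussianWassersteinSq μx Sx μy Sy ≤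
      ‖μy - μx‖ ^ 2 + Sx.trace + Sy.trace + (Y + Yᵀ).trace := by
  have := neg_trace_sqrt_le_of_fromBlocks hy hx hY
  rw [gaussianWassersteinSq, norm_sub_rev, trace_add, trace_add, trace_transpose]
  linarith

lemma exists_fromBlocks_gaussianWassersteinSq_eq (hx : Sx.PosSemidef) (hy : Sy.PosDef) :
    ∃ Y : Matrix (Fin n) (Fin n) ℝ, (fromBlocks Sx Y Yᵀ Sy).PosSemidef ∧
      ‖μy - μx‖ ^ 2 + Sx.trace + Sy.trace + (Y + Yᵀ).trace =
        gaussianWassersteinSq μx Sx μy Sy := by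
  -- The gain transports the nondegenerate `Sy` to `Sx`, so `Sx` may be singular.
  obtain ⟨K, hK, htr⟩ := exists_gain_trace_eq hy hx 1
  refine ⟨1 * K * Sy, ?_, ?_⟩
  · have := fromBlocks_posSemidef_of_gain hy.posSemidef 1 K
    rw [hK] at this
    simpa using this
  · rw [gaussianWassersteinSq, norm_sub_rev, trace_add, trace_add, trace_transpose, htr]
    simp only [one_mul, mul_one, transpose_one]
    ring

lemma gaussianWassersteinSq_nonneg (hx : Sx.PosSemidef) (hy : Sy.PosDef) :
    0 ≤ gaussianWassersteinSq μx Sx μy Sy := by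
  obtain ⟨Y, hY, heq⟩ := exists_fromBlocks_gaussianWassersteinSq_eq μx μy hx hy
  -- Compressing the block matrix by the column `[1; 1]` gives `Sx + Y + Yᵀ + Sy ⪰ 0`, whose trace
  -- is the covariance part of the distance.
  have h := posSemidef_transpose_mul_mul hY
    (fromRows (1 : Matrix (Fin n) (Fin n) ℝ) (1 : Matrix (Fin n) (Fin n) ℝ))
  have h1 := h.trace_nonneg
  rw [transpose_fromRows, fromCols_mul_fromBlocks, fromCols_mul_fromRows] at h1
  simp only [transpose_one, one_mul, mul_one, trace_add] at h1
  rw [← heq, trace_add]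
  have := sq_nonneg ‖μy - μx‖
  linarith

end Wasserstein

/-! ## Component steering problems -/

section Steering

variable {n m N : ℕ} (sys : LinearSystem n m N) (cost : QuadraticCost n m N)

lemma gramian_eq : sys.gramian = sys.BN * sys.BNᵀ := by
  ext a b
  simp only [LinearSystem.gramian, LinearSystem.BN, Matrix.sum_apply, mul_apply (M := Matrix.of _),
    Fintype.sum_prod_type_right, transpose_apply, of_apply]
  refine Finset.sum_congr rfl fun k _ => ?_
  rw [Matrix.mul_assoc (_ * _), ← transpose_mul]
  rfl

lemma dotProduct_blockDiagonal_mulVec {p : Type*} [Fintype p] [DecidableEq p] {k : ℕ}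
    (W : Fin k → Matrix p p ℝ) (v : p × Fin k → ℝ) :
    v ⬝ᵥ (blockDiagonal W *ᵥ v) = ∑ i, (fun a => v (a, i)) ⬝ᵥ (W i *ᵥ fun a => v (a, i)) := by
  simp only [dotProduct, mulVec, Fintype.sum_prod_type_right, blockDiagonal_apply, ite_mul,
    zero_mul]
  refine Finset.sum_congr rfl fun i _ => Finset.sum_congr rfl fun a _ => ?_
  rw [Finset.sum_comm]
  simp

lemma blockDiagonal_posSemidef {p : Type*} [Fintype p] [DecidableEq p] {k : ℕ}
    {W : Fin k → Matrix p p ℝ} (hW : ∀ i, (W i).PosSemidef) : (blockDiagonal W).PosSemidef := by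
  refine posSemidef_of_dotProduct ?_ fun v => ?_
  · rw [blockDiagonal_transpose]
    congr 1
    exact funext fun i => transpose_eq_of_posSemidef (hW i)
  · rw [dotProduct_blockDiagonal_mulVec]
    exact Finset.sum_nonneg fun i _ => dotProduct_mulVec_self_nonneg (hW i) _

lemma blockDiagonal_posDef {p : Type*} [Fintype p] [DecidableEq p] {k : ℕ}
    {W : Fin k → Matrix p p ℝ} (hW : ∀ i, (W i).PosDef) : (blockDiagonal W).PosDef := by
  have hpsd := blockDiagonal_posSemidef fun i => (hW i).posSemidef
  refine PosDef.of_dotProduct_mulVec_pos hpsd.1 fun v hv => ?_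
  rw [star_trivial, dotProduct_blockDiagonal_mulVec]
  have hnn := fun i => dotProduct_mulVec_self_nonneg (hW i).posSemidef (fun a => v (a, i))
  refine Finset.sum_pos' (fun i _ => hnn i) ?_
  obtain ⟨⟨a, i⟩, hai⟩ := Function.ne_iff.1 hv
  refine ⟨i, Finset.mem_univ _, ?_⟩
  have := (hW i).dotProduct_mulVec_pos (x := fun a => v (a, i)) fun h => hai (congrFun h a)
  simpa using this

variable {sys cost}

lemma bigQ_posSemidef (hQ : ∀ k, (cost.Q k).PosSemidef) : cost.bigQ.PosSemidef :=
  blockDiagonal_posSemidef hQ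

lemma bigR_posDef (hR : ∀ k, (cost.R k).PosDef) : cost.bigR.PosDef :=
  blockDiagonal_posDef hR

lemma bigM_posDef (hR : ∀ k, (cost.R k).PosDef) (hQ : ∀ k, (cost.Q k).PosSemidef) :
    (bigM sys cost).PosDef :=
  (bigR_posDef hR).add_posSemidef (posSemidef_transpose_mul_mul (bigQ_posSemidef hQ) sys.Hu)

lemma dotProduct_mulVec_add {ι : Type*} [Fintype ι] {A : Matrix ι ι ℝ} (hA : Aᵀ = A)
    (u v : ι → ℝ) :
    (u + v) ⬝ᵥ (A *ᵥ (u + v)) = u ⬝ᵥ (A *ᵥ u) + 2 * (v ⬝ᵥ (A *ᵥ u)) + v ⬝ᵥ (A *ᵥ v) := by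
  have h : u ⬝ᵥ (A *ᵥ v) = v ⬝ᵥ (A *ᵥ u) := by
    rw [dotProduct_mulVec, ← mulVec_transpose, hA, dotProduct_comm]
  rw [mulVec_add, add_dotProduct, dotProduct_add, dotProduct_add, h]
  ring

/-- Exact second-order expansion: the vector paired with `X` is half the gradient at `U`, and `bigM`
is half the Hessian. -/
lemma meanCost_add (hR : ∀ k, (cost.R k).PosDef) (hQ : ∀ k, (cost.Q k).PosSemidef)
    (μ : EuclideanSpace ℝ (Fin n)) (U X : ControlSeq m N) :
    meanCost sys cost μ (U + X) = meanCost sys cost μ U +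
      2 * (X ⬝ᵥ (bigM sys cost *ᵥ U +
        (sys.Huᵀ * cost.bigQ) *ᵥ (sys.Gam *ᵥ μ.ofLp - cost.bigRef))) +
      X ⬝ᵥ (bigM sys cost *ᵥ X) := by
  have hRT := transpose_eq_of_posSemidef (bigR_posDef hR).posSemidef
  have hQT := transpose_eq_of_posSemidef (bigQ_posSemidef hQ)
  have h1 : sys.Gam *ᵥ μ.ofLp + sys.Hu *ᵥ (U + X) - cost.bigRef =
      (sys.Gam *ᵥ μ.ofLp + sys.Hu *ᵥ U - cost.bigRef) + sys.Hu *ᵥ X := by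
    rw [mulVec_add]; abel
  have h2 : ∀ w, (sys.Hu *ᵥ X) ⬝ᵥ (cost.bigQ *ᵥ w) = X ⬝ᵥ ((sys.Huᵀ * cost.bigQ) *ᵥ w) := by
    intro w
    rw [← mulVec_mulVec, dotProduct_mulVec X, vecMul_transpose]
  have h3 : sys.Gam *ᵥ μ.ofLp + sys.Hu *ᵥ U - cost.bigRef =
      (sys.Gam *ᵥ μ.ofLp - cost.bigRef) + sys.Hu *ᵥ U := by abel
  rw [meanCost, meanCost, h1, dotProduct_mulVec_add hRT, dotProduct_mulVec_add hQT, h2, h2]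
  nth_rewrite 3 [h3]
  simp only [bigM, add_mulVec, dotProduct_add, mulVec_add, mulVec_mulVec]
  ring

lemma gramian_inv_transpose : (sys.gramian⁻¹)ᵀ = sys.gramian⁻¹ := by
  rw [transpose_nonsing_inv]
  congr 1
  rw [gramian_eq, transpose_mul, transpose_transpose]

/-! ### Consequences of controllability -/

section Gramian

variable (hctrl : IsUnit sys.gramian)
include hctrl

/-- This right inverse of `sys.BN` is the form in which controllability is used: it makes every
terminal mean and every closed-loop matrix reachable. -/
lemma gramian_mul_inv : sys.BN * (sys.BNᵀ * sys.gramian⁻¹) = 1 := by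
  rw [← Matrix.mul_assoc, ← gramian_eq, mul_nonsing_inv _ ((isUnit_iff_isUnit_det _).1 hctrl)]

lemma BN_mul_inv_mul_posDef {M : Matrix (Fin m × Fin N) (Fin m × Fin N) ℝ} (hM : M.PosDef) :
    (sys.BN * M⁻¹ * sys.BNᵀ).PosDef := by
  have h := hM.inv.mul_mul_conjTranspose_same (B := sys.BN) (by
    intro u v huv
    have huv : u ᵥ* sys.BN = v ᵥ* sys.BN := huv
    have := congrArg (· ᵥ* (sys.BNᵀ * sys.gramian⁻¹)) huv
    simpa [vecMul_vecMul, gramian_mul_inv hctrl] using this)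
  simpa [conjTranspose_eq_transpose_of_trivial] using h

/-- Dimension count: `sys.BN` is onto, so its kernel has dimension `m * N - n`, which is the rank of
`D`, and the range of `D` lies in that kernel. -/
lemma exists_eq_mul_of_BN_mul_eq_zero {D : Matrix (Fin m × Fin N) (Fin (m * N - n)) ℝ}
    (hD : D.rank = m * N - n) (hBD : sys.BN * D = 0) {v : ControlSeq m N}
    (hv : sys.BN *ᵥ v = 0) : ∃ z, v = D *ᵥ z := by
  have hsurj : LinearMap.range sys.BN.mulVecLin = ⊤ := by
    rw [LinearMap.range_eq_top]
    intro y
    refine ⟨(sys.BNᵀ * sys.gramian⁻¹) *ᵥ y, ?_⟩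
    simp [gramian_mul_inv hctrl]
  have hle : LinearMap.range D.mulVecLin ≤ LinearMap.ker sys.BN.mulVecLin := by
    rintro _ ⟨z, rfl⟩
    simp [hBD]
  have hdim := LinearMap.finrank_range_add_finrank_ker sys.BN.mulVecLin
  rw [hsurj, finrank_top] at hdim
  simp only [Module.finrank_fintype_fun_eq_card, Fintype.card_prod, Fintype.card_fin] at hdim
  have heq : LinearMap.range D.mulVecLin = LinearMap.ker sys.BN.mulVecLin := by
    refine Submodule.eq_of_le_of_finrank_eq hle ?_
    rw [← Matrix.rank, hD]
    omega
  have : v ∈ LinearMap.range D.mulVecLin := by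
    rw [heq]
    simpa using hv
  obtain ⟨z, hz⟩ := this
  exact ⟨z, by simpa using hz.symm⟩

end Gramian

/-! ### Mean steering: the multiplier formula is optimal -/

section Mean

variable (hctrl : IsUnit sys.gramian) (hR : ∀ k, (cost.R k).PosDef)
  (hQ : ∀ k, (cost.Q k).PosSemidef)
include hctrl hR hQ

lemma isMeanSteeringSolution_meanControl (μ₀ μd : EuclideanSpace ℝ (Fin n)) :
    IsMeanSteeringSolution sys cost μ₀ μd (meanControl sys cost μ₀ μd) := by
  have hM : (bigM sys cost).PosDef := bigM_posDef hR hQ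
  have hMdet := (isUnit_iff_isUnit_det _).1 hM.isUnit
  have hBMB := (isUnit_iff_isUnit_det _).1 (BN_mul_inv_mul_posDef hctrl hM).isUnit
  have hmem : meanControl sys cost μ₀ μd ∈ meanSteeringSet sys μ₀ μd := by
    change μd.ofLp = _
    have h : sys.BN *ᵥ meanControl sys cost μ₀ μd = μd.ofLp - sys.PhiN *ᵥ μ₀.ofLp := by
      simp only [meanControl, meanMultiplier, mulVec_smul, mulVec_sub, smul_sub, mulVec_mulVec,
        smul_smul, ← Matrix.mul_assoc]
      rw [mul_nonsing_inv _ hBMB, one_mulVec]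
      norm_num
    rw [h]
    abel
  refine ⟨hmem, isMinOn_iff.2 fun U hU => ?_⟩
  have hB : sys.BN *ᵥ (U - meanControl sys cost μ₀ μd) = 0 := by
    have h1 : μd.ofLp = _ := hU
    have h2 : μd.ofLp = _ := hmem
    rw [h1] at h2
    rw [mulVec_sub, add_left_cancel h2, sub_self]
  -- Stationarity: the gradient lies in the range of `𝐁ᵀ`, hence is orthogonal to all feasible
  -- directions, which form `ker 𝐁`. Positivity of the quadratic term then gives optimality.
  have hstat : bigM sys cost *ᵥ meanControl sys cost μ₀ μd +
      (sys.Huᵀ * cost.bigQ) *ᵥ (sys.Gam *ᵥ μ₀.ofLp - cost.bigRef) =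
      sys.BNᵀ *ᵥ ((1 / 2 : ℝ) • meanMultiplier sys cost μ₀ μd) := by
    rw [meanControl, mulVec_smul, mulVec_mulVec, mul_nonsing_inv _ hMdet, one_mulVec, smul_sub,
      smul_smul, mulVec_smul]
    norm_num
  have hexp := meanCost_add (sys := sys) hR hQ μ₀ (meanControl sys cost μ₀ μd) (U - meanControl sys cost μ₀ μd)
  rw [add_sub_cancel, hstat, dotProduct_mulVec, vecMul_transpose, hB, zero_dotProduct] at hexp
  have := dotProduct_mulVec_self_nonneg hM.posSemidef (U - meanControl sys cost μ₀ μd)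
  linarith

lemma meanCostOpt_le {μ₀ μd : EuclideanSpace ℝ (Fin n)} {U : ControlSeq m N}
    (hU : U ∈ meanSteeringSet sys μ₀ μd) :
    meanCostOpt sys cost μ₀ μd ≤ meanCost sys cost μ₀ U :=
  (isMeanSteeringSolution_meanControl hctrl hR hQ μ₀ μd).2 hU

lemma meanCost_le_of_isMeanSteeringSolution {μ₀ μd : EuclideanSpace ℝ (Fin n)}
    {U : ControlSeq m N} (hU : IsMeanSteeringSolution sys cost μ₀ μd U) :
    meanCost sys cost μ₀ U ≤ meanCostOpt sys cost μ₀ μd :=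
  hU.2 (isMeanSteeringSolution_meanControl hctrl hR hQ μ₀ μd).1

end Mean

/-! ### Covariance steering: reduction to the closed-loop matrix and lossless relaxation -/

section Covariance

lemma trace_mul_mul_add {ι κ : Type*} [Fintype ι] [Fintype κ] {W : Matrix ι ι ℝ}
    {S : Matrix κ κ ℝ} (hW : Wᵀ = W) (hS : Sᵀ = S) (A X : Matrix ι κ ℝ) :
    (W * (A + X) * S * (A + X)ᵀ).trace =
      (W * A * S * Aᵀ).trace + 2 * (Xᵀ * W * A * S).trace + (W * X * S * Xᵀ).trace := by
  have h1 : (W * A * S * Xᵀ).trace = (Xᵀ * W * A * S).trace := by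
    rw [trace_mul_comm]; simp only [Matrix.mul_assoc]
  have h2 : (W * X * S * Aᵀ).trace = (Xᵀ * W * A * S).trace := by
    rw [← trace_transpose]
    simp only [transpose_mul, transpose_transpose, hW, hS]
    rw [← Matrix.mul_assoc, trace_mul_comm]
    simp only [Matrix.mul_assoc]
  simp only [transpose_add, Matrix.mul_add, Matrix.add_mul, trace_add, h1, h2]
  ring

lemma covCost_add (hR : ∀ k, (cost.R k).PosDef) (hQ : ∀ k, (cost.Q k).PosSemidef)
    {S : Matrix (Fin n) (Fin n) ℝ} (hS : S.PosSemidef) (L X : Matrix (Fin m × Fin N) (Fin n) ℝ) :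
    covCost sys cost S (L + X) = covCost sys cost S L +
      2 * (Xᵀ * (bigM sys cost * L + sys.Huᵀ * cost.bigQ * sys.Gam) * S).trace +
      (bigM sys cost * X * S * Xᵀ).trace := by
  have hRT := transpose_eq_of_posSemidef (bigR_posDef hR).posSemidef
  have hQT := transpose_eq_of_posSemidef (bigQ_posSemidef hQ)
  have hST := transpose_eq_of_posSemidef hS
  have h1 : sys.Gam + sys.Hu * (L + X) = (sys.Gam + sys.Hu * L) + sys.Hu * X := by
    rw [Matrix.mul_add, add_assoc]
  have h2 : (cost.bigQ * (sys.Hu * X) * S * (sys.Hu * X)ᵀ).trace =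
      (sys.Huᵀ * cost.bigQ * sys.Hu * X * S * Xᵀ).trace := by
    rw [transpose_mul, ← Matrix.mul_assoc, trace_mul_comm]
    simp only [Matrix.mul_assoc]
  rw [covCost, covCost, h1, trace_mul_mul_add hRT hST, trace_mul_mul_add hQT hST, h2]
  simp only [bigM, Matrix.add_mul, Matrix.mul_add, trace_add, transpose_mul, Matrix.mul_assoc]
  ring

variable {d : ℕ} {D : Matrix (Fin m × Fin N) (Fin d) ℝ}

/-- The optimal gain among those with closed-loop matrix `K`. -/
def gainOf (sys : LinearSystem n m N) (cost : QuadraticCost n m N)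
    (D : Matrix (Fin m × Fin N) (Fin d) ℝ) (K : Matrix (Fin n) (Fin n) ℝ) :
    Matrix (Fin m × Fin N) (Fin n) ℝ :=
  -Theta4 sys cost D + Theta1 sys cost D * (sys.BNᵀ * sys.gramian⁻¹) * K

/-- The cost is expanded around the gain `-Θ₄`, whose closed loop is zero when
`PhiN_add_BN_mul_gainOf` applies. The increment is `E K` with `E = Θ₁ 𝐁ᵀ 𝒢⁻¹`; the constant, linear
and quadratic terms produce `Θ₇`, `Θ₈` and `Θ₆`. -/
lemma covCost_gainOf (hR : ∀ k, (cost.R k).PosDef)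
    (hQ : ∀ k, (cost.Q k).PosSemidef) {S : Matrix (Fin n) (Fin n) ℝ} (hS : S.PosSemidef)
    (K : Matrix (Fin n) (Fin n) ℝ) :
    covCost sys cost S (gainOf sys cost D K) =
      (Theta6 sys cost D * (K * S * Kᵀ)).trace + (Theta7 sys cost D * S).trace +
        2 * (Theta8 sys cost D * K * S).trace := by
  have hRT := transpose_eq_of_posSemidef (bigR_posDef hR).posSemidef
  have hQT := transpose_eq_of_posSemidef (bigQ_posSemidef hQ)
  have hST := transpose_eq_of_posSemidef hS
  set E := Theta1 sys cost D * (sys.BNᵀ * sys.gramian⁻¹) with hE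
  have h6 : Theta6 sys cost D = Eᵀ * bigM sys cost * E := by
    simp only [Theta6, hE, transpose_mul, transpose_transpose, gramian_inv_transpose,
      Matrix.mul_assoc]
  have h0 : covCost sys cost S (-Theta4 sys cost D) = (Theta7 sys cost D * S).trace := by
    have h5 : sys.Gam + sys.Hu * -Theta4 sys cost D = Theta5 sys cost D := by
      rw [Theta5, Matrix.mul_neg, sub_eq_add_neg]
    rw [covCost, h5, Theta7, Matrix.add_mul, trace_add]
    congr 1
    · rw [trace_mul_comm, transpose_neg]
      simp only [Matrix.neg_mul, Matrix.mul_neg, neg_neg, Matrix.mul_assoc]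
    · rw [trace_mul_comm]
      simp only [Matrix.mul_assoc]
  -- `Θ₈` is the transposed half-gradient of the cost at `-Θ₄`, multiplied by `E`.
  have h8 : Theta8 sys cost D =
      (bigM sys cost * -Theta4 sys cost D + sys.Huᵀ * cost.bigQ * sys.Gam)ᵀ * E := by
    rw [Theta8, hE, ← Matrix.mul_assoc, ← Matrix.mul_assoc]
    congr 3
    simp only [bigM, Theta5, transpose_add, transpose_mul, transpose_neg, transpose_sub,
      transpose_transpose, hRT, hQT, Matrix.sub_mul, Matrix.mul_add, Matrix.neg_mul, Matrix.mul_assoc]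
    abel
  rw [gainOf, covCost_add hR hQ hS, h0, h6, h8]
  have h9 : ((E * K)ᵀ * (bigM sys cost * -Theta4 sys cost D +
      sys.Huᵀ * cost.bigQ * sys.Gam) * S).trace =
      ((bigM sys cost * -Theta4 sys cost D + sys.Huᵀ * cost.bigQ * sys.Gam)ᵀ * E * K * S).trace := by
    rw [← trace_transpose]
    simp only [transpose_mul (_ * _), hST]
    rw [transpose_mul, transpose_transpose, trace_mul_comm]
    simp only [Matrix.mul_assoc]
  have h10 : (bigM sys cost * (E * K) * S * (E * K)ᵀ).trace =
      (Eᵀ * bigM sys cost * E * (K * S * Kᵀ)).trace := by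
    rw [transpose_mul, ← Matrix.mul_assoc, trace_mul_comm]
    simp only [Matrix.mul_assoc]
  rw [h9, h10]
  ring

lemma BN_mul_Theta1 (hBD : sys.BN * D = 0) : sys.BN * Theta1 sys cost D = sys.BN := by
  simp only [Theta1, Matrix.mul_sub, ← Matrix.mul_assoc, hBD, Matrix.zero_mul, Matrix.mul_one, sub_zero]

lemma BN_mul_Theta2 (hBD : sys.BN * D = 0) : sys.BN * Theta2 sys cost D = 0 := by
  simp only [Theta2, ← Matrix.mul_assoc, hBD, Matrix.zero_mul]

lemma PhiN_add_BN_mul_gainOf (hctrl : IsUnit sys.gramian) (hBD : sys.BN * D = 0)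
    (K : Matrix (Fin n) (Fin n) ℝ) : sys.PhiN + sys.BN * gainOf sys cost D K = K := by
  have h : ∀ X : Matrix (Fin m × Fin N) (Fin n) ℝ,
      sys.BN * (Theta1 sys cost D * X) = sys.BN * X := fun X => by
    rw [← Matrix.mul_assoc, BN_mul_Theta1 hBD]
  have h' : sys.BN * (sys.BNᵀ * sys.gramian⁻¹ * sys.PhiN) = sys.PhiN := by
    rw [← Matrix.mul_assoc, gramian_mul_inv hctrl, Matrix.one_mul]
  rw [gainOf, Theta4, Theta3, Matrix.mul_add, Matrix.mul_neg, Matrix.mul_add, BN_mul_Theta2 hBD,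
    h, h', Matrix.mul_assoc (Theta1 sys cost D), h, ← Matrix.mul_assoc, gramian_mul_inv hctrl]
  simp

/-- Two gains with the same closed loop differ by a matrix whose columns lie in the range of `D`.
The cost is stationary at `gainOf` in all these directions, and its quadratic part is nonnegative.
-/
lemma covCost_gainOf_le (hctrl : IsUnit sys.gramian) (hR : ∀ k, (cost.R k).PosDef)
    (hQ : ∀ k, (cost.Q k).PosSemidef) {D : Matrix (Fin m × Fin N) (Fin (m * N - n)) ℝ}
    (hD : D.rank = m * N - n) (hBD : sys.BN * D = 0)
    {S : Matrix (Fin n) (Fin n) ℝ} (hS : S.PosSemidef) (L : Matrix (Fin m × Fin N) (Fin n) ℝ) :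
    covCost sys cost S (gainOf sys cost D (sys.PhiN + sys.BN * L)) ≤ covCost sys cost S L := by
  have hM : (bigM sys cost).PosDef := bigM_posDef hR hQ
  set K := sys.PhiN + sys.BN * L with hK
  have hB : sys.BN * (L - gainOf sys cost D K) = 0 := by
    have h1 := PhiN_add_BN_mul_gainOf (cost := cost) hctrl hBD K
    nth_rewrite 2 [hK] at h1
    rw [Matrix.mul_sub, add_left_cancel h1, sub_self]
  -- Full column rank makes `Dᵀ M D` positive definite, so the inverse in `Θ₁` and `Θ₂` is genuine.
  have hinj : Function.Injective D.mulVec := by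
    have h := LinearMap.finrank_range_add_finrank_ker D.mulVecLin
    rw [← Matrix.rank, hD] at h
    simp only [Module.finrank_fintype_fun_eq_card, Fintype.card_fin] at h
    have hker : LinearMap.ker D.mulVecLin = ⊥ := Submodule.finrank_eq_zero.1 (by omega)
    exact LinearMap.ker_eq_bot.1 hker
  have hDMD : (Dᵀ * bigM sys cost * D).PosDef := by
    have := hM.conjTranspose_mul_mul_same (B := D) hinj
    simpa [conjTranspose_eq_transpose_of_trivial] using this
  have hdet := (isUnit_iff_isUnit_det _).1 hDMD.isUnit
  have h1 : Dᵀ * bigM sys cost * Theta1 sys cost D = 0 := by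
    rw [Theta1, Matrix.mul_sub, Matrix.mul_one, ← Matrix.mul_assoc, ← Matrix.mul_assoc, ← Matrix.mul_assoc,
      mul_nonsing_inv _ hdet, Matrix.one_mul, sub_self]
  have h2 : Dᵀ * bigM sys cost * Theta2 sys cost D = Dᵀ * (sys.Huᵀ * cost.bigQ * sys.Gam) := by
    simp only [Theta2, ← Matrix.mul_assoc]
    rw [mul_nonsing_inv _ hdet, Matrix.one_mul]
  have hstat : Dᵀ * (bigM sys cost * gainOf sys cost D K + sys.Huᵀ * cost.bigQ * sys.Gam) = 0 := by
    rw [Matrix.mul_add, ← Matrix.mul_assoc, gainOf, Theta4, Matrix.mul_add, Matrix.mul_neg,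
      Matrix.mul_add, h2, ← Matrix.mul_assoc _ (Theta1 sys cost D), h1, Matrix.mul_assoc (Theta1 sys cost D),
      ← Matrix.mul_assoc _ (Theta1 sys cost D), h1]
    simp
  -- The kernel description is applied to each column, and the coefficient vectors are assembled
  -- into one matrix.
  choose z hz using fun j : Fin n => exists_eq_mul_of_BN_mul_eq_zero hctrl hD hBD
    (v := (L - gainOf sys cost D K).col j) (by
      have := congrArg (fun A : Matrix _ _ ℝ => A.col j) hB
      exact this)
  have hX : L - gainOf sys cost D K = D * (Matrix.of z)ᵀ := by
    ext a j
    exact congrFun (hz j) a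
  have hexp := covCost_add hR hQ (sys := sys) hS (gainOf sys cost D K) (L - gainOf sys cost D K)
  have hzero : (L - gainOf sys cost D K)ᵀ *
      (bigM sys cost * gainOf sys cost D K + sys.Huᵀ * cost.bigQ * sys.Gam) = 0 := by
    rw [hX, transpose_mul, Matrix.mul_assoc, hstat, Matrix.mul_zero]
  rw [add_sub_cancel, hzero, Matrix.zero_mul, trace_zero] at hexp
  have hnn := trace_mul_nonneg hM.posSemidef
    (posSemidef_mul_mul_transpose hS (L - gainOf sys cost D K))
  simp only [← Matrix.mul_assoc] at hnn
  linarith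

variable (hctrl : IsUnit sys.gramian) (hR : ∀ k, (cost.R k).PosDef)
  (hQ : ∀ k, (cost.Q k).PosSemidef) {D : Matrix (Fin m × Fin N) (Fin (m * N - n)) ℝ}
  (hD : D.rank = m * N - n) (hBD : sys.BN * D = 0) {S₀ S₁ : Matrix (Fin n) (Fin n) ℝ}
include hctrl hR hQ hD hBD

/-- Every admissible gain gives a point of the semidefinite relaxation with smaller cost. -/
lemma exists_fromBlocks_le_covCost (h₀ : S₀.PosSemidef) {L : Matrix (Fin m × Fin N) (Fin n) ℝ}
    (hL : L ∈ covSteeringSet sys S₀ S₁) :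
    ∃ X : Matrix (Fin n) (Fin n) ℝ,
      (fromBlocks (Theta8 sys cost D * S₁ * (Theta8 sys cost D)ᵀ) X Xᵀ S₀).PosSemidef ∧
      (Theta6 sys cost D * S₁).trace + (Theta7 sys cost D * S₀).trace + (X + Xᵀ).trace ≤
        covCost sys cost S₀ L := by
  have hL : S₁ = _ := hL
  refine ⟨Theta8 sys cost D * (sys.PhiN + sys.BN * L) * S₀, ?_, ?_⟩
  · rw [hL]
    exact fromBlocks_posSemidef_of_gain h₀ _ _
  · have h1 := covCost_gainOf_le hctrl hR hQ hD hBD h₀ L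
    rw [covCost_gainOf hR hQ h₀, ← hL] at h1
    rw [trace_add, trace_transpose]
    linarith

/-- The covariance steering problem has a solution that attains the value of the semidefinite
relaxation. -/
lemma exists_isCovSteeringSolution (h₀ : S₀.PosDef) (h₁ : S₁.PosSemidef) :
    ∃ L, IsCovSteeringSolution sys cost S₀ S₁ L ∧ ∀ X : Matrix (Fin n) (Fin n) ℝ,
      (fromBlocks (Theta8 sys cost D * S₁ * (Theta8 sys cost D)ᵀ) X Xᵀ S₀).PosSemidef →
      covCost sys cost S₀ L ≤
        (Theta6 sys cost D * S₁).trace + (Theta7 sys cost D * S₀).trace + (X + Xᵀ).trace := by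
  obtain ⟨K, hK, htr⟩ := exists_gain_trace_eq h₀ h₁ (Theta8 sys cost D)
  have hle : ∀ X : Matrix (Fin n) (Fin n) ℝ,
      (fromBlocks (Theta8 sys cost D * S₁ * (Theta8 sys cost D)ᵀ) X Xᵀ S₀).PosSemidef →
      covCost sys cost S₀ (gainOf sys cost D K) ≤
        (Theta6 sys cost D * S₁).trace + (Theta7 sys cost D * S₀).trace + (X + Xᵀ).trace := by
    intro X hX
    have := neg_trace_sqrt_le_of_fromBlocks h₀
      (posSemidef_mul_mul_transpose h₁ (Theta8 sys cost D)) hX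
    -- After `hK` the first two terms on both sides agree; `htr` says that the third attains the
    -- lower bound valid for every feasible `X`.
    rw [covCost_gainOf hR hQ h₀.posSemidef, hK, trace_add X, trace_transpose, htr]
    linarith
  refine ⟨gainOf sys cost D K, ⟨?_, fun L hL => ?_⟩, hle⟩
  · change S₁ = _
    rw [PhiN_add_BN_mul_gainOf hctrl hBD, hK]
  · obtain ⟨X, hX, hXle⟩ := exists_fromBlocks_le_covCost hctrl hR hQ hD hBD h₀.posSemidef hL
    exact (hle X hX).trans hXle

lemma covCost_le_of_isCovSteeringSolution (h₀ : S₀.PosDef) (h₁ : S₁.PosSemidef)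
    {L : Matrix (Fin m × Fin N) (Fin n) ℝ} (hL : IsCovSteeringSolution sys cost S₀ S₁ L)
    {X : Matrix (Fin n) (Fin n) ℝ}
    (hX : (fromBlocks (Theta8 sys cost D * S₁ * (Theta8 sys cost D)ᵀ) X Xᵀ S₀).PosSemidef) :
    covCost sys cost S₀ L ≤
      (Theta6 sys cost D * S₁).trace + (Theta7 sys cost D * S₀).trace + (X + Xᵀ).trace := by
  obtain ⟨L', hL', hle⟩ := exists_isCovSteeringSolution hctrl hR hQ hD hBD h₀ h₁
  exact (hL.2 hL'.1).trans (hle X hX)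

end Covariance

end Steering

/-! ## Trajectories -/

section Trajectory

variable {n m N : ℕ} (sys : LinearSystem n m N) (cost : QuadraticCost n m N)

lemma transition_zero (k : Fin (N + 1)) : sys.transition 0 k = 1 := rfl

lemma transition_succ (k : Fin N) (l : Fin (N + 1)) :
    sys.transition k.succ l =
      if l ≤ k.castSucc then sys.A k * sys.transition k.castSucc l else 1 := by
  simp only [LinearSystem.transition, Fin.induction_succ]

lemma transition_self (k : Fin (N + 1)) : sys.transition k k = 1 := by
  induction k using Fin.cases with
  | zero => rfl
  | succ k => rw [transition_succ, if_neg (by simp [Fin.le_def])]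

lemma trajectory_zero (x₀ : Fin n → ℝ) (U : ControlSeq m N) : sys.trajectory x₀ U 0 = x₀ := rfl

lemma trajectory_succ (x₀ : Fin n → ℝ) (U : ControlSeq m N) (k : Fin N) :
    sys.trajectory x₀ U k.succ =
      sys.A k *ᵥ sys.trajectory x₀ U k.castSucc + sys.B k *ᵥ fun a => U (a, k) := by
  simp only [LinearSystem.trajectory, Fin.induction_succ]

lemma trajectory_eq_sum (x₀ : Fin n → ℝ) (U : ControlSeq m N) (k : Fin (N + 1)) :
    sys.trajectory x₀ U k = sys.transition k 0 *ᵥ x₀ +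
      ∑ l : Fin N, if l.castSucc < k then
        (sys.transition k l.succ * sys.B l) *ᵥ (fun a => U (a, l)) else 0 := by
  induction k using Fin.induction with
  | zero => simp [trajectory_zero, transition_zero]
  | succ k ih =>
    rw [trajectory_succ, ih, transition_succ, if_pos (Fin.zero_le _), mulVec_add, mulVec_mulVec,
      add_assoc]
    congr 1
    -- Inputs earlier than `k` are propagated by `A k`, the input at time `k` enters through `B k`
    -- since `Φ_{k+1,k+1} = 1`, and later inputs do not contribute.
    have hterm : ∀ l : Fin N, (if l.castSucc < k.succ then
        (sys.transition k.succ l.succ * sys.B l) *ᵥ (fun a => U (a, l)) else 0) =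
        sys.A k *ᵥ (if l.castSucc < k.castSucc then
          (sys.transition k.castSucc l.succ * sys.B l) *ᵥ (fun a => U (a, l)) else 0) +
        if l = k then sys.B k *ᵥ (fun a => U (a, k)) else 0 := by
      intro l
      rcases lt_trichotomy l k with h | h | h
      · have h1 : l.castSucc < k.succ := by simp only [Fin.lt_def] at *; simp; omega
        have h2 : l.castSucc < k.castSucc := by simpa using h
        have h3 : l.succ ≤ k.castSucc := by simp only [Fin.lt_def, Fin.le_def] at *; simp; omega
        rw [if_pos h1, if_pos h2, if_neg h.ne, transition_succ, if_pos h3, mulVec_mulVec,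
          add_zero, Matrix.mul_assoc]
      · subst h
        rw [if_pos (by simp [Fin.lt_def]), if_neg (lt_irrefl _), if_pos rfl, transition_self,
          Matrix.one_mul, mulVec_zero, zero_add]
      · have h1 : ¬ l.castSucc < k.succ := by simp only [Fin.lt_def] at *; simp; omega
        have h2 : ¬ l.castSucc < k.castSucc := by simpa using h.le
        rw [if_neg h1, if_neg h2, if_neg h.ne', mulVec_zero, add_zero]
    rw [Finset.sum_congr rfl fun l _ => hterm l, Finset.sum_add_distrib, ← Matrix.mulVec_sum]
    simp

lemma trajectory_apply (x₀ : Fin n → ℝ) (U : ControlSeq m N) (k : Fin (N + 1)) (a : Fin n) :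
    sys.trajectory x₀ U k a = (sys.Gam *ᵥ x₀ + sys.Hu *ᵥ U) (a, k) := by
  rw [trajectory_eq_sum, Pi.add_apply, Pi.add_apply, Finset.sum_apply]
  congr 1
  simp only [LinearSystem.Hu, mulVec, dotProduct, Fintype.sum_prod_type_right, of_apply]
  refine Finset.sum_congr rfl fun l _ => ?_
  split_ifs <;> simp [mulVec, dotProduct]

lemma trajectory_last (x₀ : Fin n → ℝ) (U : ControlSeq m N) :
    sys.trajectory x₀ U (Fin.last N) = sys.PhiN *ᵥ x₀ + sys.BN *ᵥ U := by
  rw [trajectory_eq_sum]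
  congr 1
  ext a
  rw [Finset.sum_apply]
  simp only [LinearSystem.BN, mulVec, dotProduct, Fintype.sum_prod_type_right, of_apply]
  refine Finset.sum_congr rfl fun l _ => ?_
  rw [if_pos (Fin.castSucc_lt_last l)]
  rfl

/-- `meanCost` thus also serves as the pathwise cost, with the random initial state in the place of
the mean. -/
lemma realizedCost_eq_meanCost (z : EuclideanSpace ℝ (Fin n) × ControlSeq m N) :
    realizedCost sys cost z = meanCost sys cost z.1 z.2 := by
  have h : ∀ k, (fun a => (sys.Gam *ᵥ z.1.ofLp + sys.Hu *ᵥ z.2 - cost.bigRef) (a, k)) =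
      sys.trajectory z.1.ofLp z.2 k - cost.ref k := by
    intro k
    ext a
    rw [Pi.sub_apply, Pi.sub_apply, trajectory_apply]
    rfl
  rw [realizedCost, QuadraticCost.total, meanCost, QuadraticCost.bigR, QuadraticCost.bigQ,
    dotProduct_blockDiagonal_mulVec, dotProduct_blockDiagonal_mulVec, Fin.sum_univ_castSucc]
  simp only [h, wsq, Finset.sum_add_distrib]
  ring

/-- Along an affine feedback law the cost is a quadratic polynomial in the deviation of the initial
state from the mean. -/
lemma meanCost_feedback {cost : QuadraticCost n m N} (hR : ∀ k, (cost.R k).PosDef)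
    (hQ : ∀ k, (cost.Q k).PosSemidef) (μ : EuclideanSpace ℝ (Fin n))
    (L : Matrix (Fin m × Fin N) (Fin n) ℝ) (U : ControlSeq m N) :
    ∃ b : Fin n → ℝ, ∀ x : EuclideanSpace ℝ (Fin n),
      meanCost sys cost x (L *ᵥ (x - μ).ofLp + U) = meanCost sys cost μ U +
        b ⬝ᵥ (x - μ).ofLp + (x - μ).ofLp ⬝ᵥ
          ((Lᵀ * cost.bigR * L + (sys.Gam + sys.Hu * L)ᵀ * cost.bigQ * (sys.Gam + sys.Hu * L)) *ᵥ
            (x - μ).ofLp) := by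
  have hRT := transpose_eq_of_posSemidef (bigR_posDef hR).posSemidef
  have hQT := transpose_eq_of_posSemidef (bigQ_posSemidef hQ)
  set c := sys.Gam *ᵥ μ.ofLp + sys.Hu *ᵥ U - cost.bigRef with hc
  set F := sys.Gam + sys.Hu * L with hF
  -- The linear coefficient may stay existential: its expectation under a Gaussian centred at `μ`
  -- vanishes.
  refine ⟨(2 : ℝ) • (Lᵀ *ᵥ (cost.bigR *ᵥ U) + Fᵀ *ᵥ (cost.bigQ *ᵥ c)), fun x => ?_⟩
  set y := (x - μ).ofLp with hy
  have hx : x.ofLp = μ.ofLp + y := by simp [hy]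
  have h1 : sys.Gam *ᵥ x.ofLp + sys.Hu *ᵥ (L *ᵥ y + U) - cost.bigRef = c + F *ᵥ y := by
    rw [hx, hc, hF, add_mulVec, mulVec_add, mulVec_add, mulVec_mulVec]
    abel
  have h2 : ∀ {κ : Type} [Fintype κ] (G : Matrix κ (Fin n) ℝ) (w : κ → ℝ),
      (G *ᵥ y) ⬝ᵥ w = y ⬝ᵥ (Gᵀ *ᵥ w) := by
    intro κ _ G w
    rw [dotProduct_mulVec, vecMul_transpose]
  rw [meanCost, meanCost, h1, add_comm (L *ᵥ y), dotProduct_mulVec_add hRT,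
    dotProduct_mulVec_add hQT, h2, h2, h2, h2, ← hc]
  simp only [add_mulVec, dotProduct_add, mulVec_mulVec, dotProduct_smul, smul_eq_mul,
    Matrix.mul_assoc, dotProduct_comm _ y]
  ring

end Trajectory

/-! ## Multivariate Gaussians -/

section Gaussian

open scoped RealInnerProductSpace ENNReal

variable {n : ℕ}

/-- Both measures have the same characteristic function, by the Fourier transform of the Gaussian.
Densities are needed because the policy is defined by posterior ratios of densities. -/
lemma stdGaussian_eq_withDensity :
    stdGaussian (EuclideanSpace ℝ (Fin n)) = (volume : Measure (EuclideanSpace ℝ (Fin n))).withDensity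
      fun x => ENNReal.ofReal ((√((2 * Real.pi) ^ n))⁻¹ * Real.exp (-(1 / 2) * ‖x‖ ^ 2)) := by
  set φ : EuclideanSpace ℝ (Fin n) → ℝ :=
    fun x => (√((2 * Real.pi) ^ n))⁻¹ * Real.exp (-(1 / 2) * ‖x‖ ^ 2) with hφ
  have hφ0 : ∀ x, 0 ≤ φ x := fun x => by positivity
  have hφm : Measurable φ := by fun_prop
  have hpow : (Real.pi / (1 / 2 : ℝ)) ^ ((Module.finrank ℝ (EuclideanSpace ℝ (Fin n)) : ℝ) / 2) =
      √((2 * Real.pi) ^ n) := by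
    rw [finrank_euclideanSpace_fin, Real.sqrt_eq_rpow, ← Real.rpow_natCast, ← Real.rpow_mul
      (by positivity)]
    congr 1
    · ring
    · ring
  have hint : Integrable φ := by
    refine Integrable.const_mul ?_ _
    -- The Bochner integral of a nonintegrable function is zero by convention, so a nonzero value
    -- proves integrability.
    refine Integrable.of_integral_ne_zero ?_
    rw [GaussianFourier.integral_rexp_neg_mul_sq_norm (by norm_num), hpow]
    positivity
  have : IsFiniteMeasure ((volume : Measure (EuclideanSpace ℝ (Fin n))).withDensity
      fun x => ENNReal.ofReal (φ x)) := isFiniteMeasure_withDensity_ofReal hint.2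
  refine Measure.ext_of_charFun ?_
  ext t
  rw [charFun_stdGaussian, charFun_apply,
    integral_withDensity_eq_integral_toReal_smul hφm.ennreal_ofReal
      (Filter.Eventually.of_forall fun _ => ENNReal.ofReal_lt_top)]
  have h1 : ∀ x : EuclideanSpace ℝ (Fin n),
      (ENNReal.ofReal (φ x)).toReal • Complex.exp (⟪x, t⟫ * Complex.I) =
      ((√((2 * Real.pi) ^ n))⁻¹ : ℝ) *
        Complex.exp (-(1 / 2 : ℂ) * ‖x‖ ^ 2 + Complex.I * ⟪t, x⟫) := by
    intro x
    rw [ENNReal.toReal_ofReal (hφ0 x), Complex.real_smul, hφ, Complex.ofReal_mul,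
      Complex.ofReal_exp, mul_assoc, ← Complex.exp_add, real_inner_comm]
    push_cast
    ring_nf
  simp_rw [h1]
  rw [integral_const_mul, GaussianFourier.integral_cexp_neg_mul_sq_norm_add (by norm_num)]
  have h2 : ((Real.pi : ℂ) / (1 / 2)) ^ ((Module.finrank ℝ (EuclideanSpace ℝ (Fin n)) : ℂ) / 2) =
      ((√((2 * Real.pi) ^ n) : ℝ) : ℂ) := by
    rw [← hpow, Complex.ofReal_cpow (by positivity)]
    push_cast
    rfl
  rw [h2, ← mul_assoc, ← Complex.ofReal_mul, inv_mul_cancel₀ (by positivity), Complex.ofReal_one,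
    one_mul, Complex.I_sq]
  ring_nf

lemma gaussianDensity_pos {μ : EuclideanSpace ℝ (Fin n)} {S : Matrix (Fin n) (Fin n) ℝ}
    (hS : S.PosDef) (x : EuclideanSpace ℝ (Fin n)) : 0 < gaussianDensity μ S x := by
  have := hS.det_pos
  unfold gaussianDensity
  positivity

lemma measurable_gaussianDensity (μ : EuclideanSpace ℝ (Fin n)) (S : Matrix (Fin n) (Fin n) ℝ) :
    Measurable (gaussianDensity μ S) := by
  apply Continuous.measurable
  unfold gaussianDensity
  simp only [dotProduct, Matrix.mulVec]
  fun_prop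

/-- The measure is the image of the standard Gaussian under `x ↦ μ + S^{1/2} x`. The change of
variables contributes `|det S^{1/2}|`, which accounts for `det S` in the normalisation. -/
lemma multivariateGaussian_eq_withDensity (μ : EuclideanSpace ℝ (Fin n))
    {S : Matrix (Fin n) (Fin n) ℝ} (hS : S.PosDef) :
    multivariateGaussian μ S = (volume : Measure (EuclideanSpace ℝ (Fin n))).withDensity
      fun x => ENNReal.ofReal (gaussianDensity μ S x) := by
  set s := CFC.sqrt S with hs
  have hss : s * s = S := sqrt_mul_self hS.posSemidef
  have hsT : sᵀ = s := sqrt_transpose S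
  have hdet : s.det ≠ 0 := by
    intro h
    have := hS.det_pos
    rw [← hss, det_mul, h] at this
    simp at this
  set A : EuclideanSpace ℝ (Fin n) →L[ℝ] EuclideanSpace ℝ (Fin n) :=
    toEuclideanCLM (𝕜 := ℝ) s with hA
  have hAdet : LinearMap.det (A : EuclideanSpace ℝ (Fin n) →ₗ[ℝ] EuclideanSpace ℝ (Fin n)) =
      s.det := by
    have : (A : EuclideanSpace ℝ (Fin n) →ₗ[ℝ] EuclideanSpace ℝ (Fin n)) = toEuclideanLin s := rfl
    rw [this, toEuclideanLin_eq_toLin_orthonormal, LinearMap.det_toLin]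
  have hT : Measurable fun x => μ + A x := by fun_prop
  have hmap : (volume : Measure (EuclideanSpace ℝ (Fin n))).map (fun x => μ + A x) =
      ENNReal.ofReal |s.det⁻¹| • volume := by
    have h1 := Measure.map_linearMap_addHaar_eq_smul_addHaar
      (volume : Measure (EuclideanSpace ℝ (Fin n)))
      (f := (A : EuclideanSpace ℝ (Fin n) →ₗ[ℝ] EuclideanSpace ℝ (Fin n))) (by rwa [hAdet])
    rw [hAdet] at h1
    have h2 : (fun x => μ + A x) = (fun x => μ + x) ∘ A := rfl
    rw [h2, ← Measure.map_map (by fun_prop) (by fun_prop)]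
    have h3 : Measure.map A (volume : Measure (EuclideanSpace ℝ (Fin n))) =
      ENNReal.ofReal |s.det⁻¹| • volume := h1
    rw [h3, Measure.map_smul, map_add_left_eq_self]
  have hvol : (volume : Measure (EuclideanSpace ℝ (Fin n))) =
      ENNReal.ofReal |s.det| • volume.map (fun x => μ + A x) := by
    rw [hmap, smul_smul, ← ENNReal.ofReal_mul (abs_nonneg _), ← abs_mul, mul_inv_cancel₀ hdet]
    simp
  have hdens : ∀ x, |s.det| * gaussianDensity μ S (μ + A x) =
      (√((2 * Real.pi) ^ n))⁻¹ * Real.exp (-(1 / 2) * ‖x‖ ^ 2) := by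
    intro x
    have h1 : (μ + A x - μ).ofLp = s *ᵥ x.ofLp := by
      rw [add_sub_cancel_left]; rfl
    have h2 : (s *ᵥ x.ofLp) ⬝ᵥ (S⁻¹ *ᵥ (s *ᵥ x.ofLp)) = ‖x‖ ^ 2 := by
      have h3 : s * (s⁻¹ * s⁻¹) * s = 1 := by
        rw [← mul_assoc, sqrt_mul_inv hS, one_mul, sqrt_inv_mul hS]
      have h4 : s *ᵥ x.ofLp = x.ofLp ᵥ* s := by rw [← vecMul_transpose, hsT]
      nth_rewrite 1 [h4]
      rw [← dotProduct_mulVec, mulVec_mulVec, mulVec_mulVec, ← hss, Matrix.mul_inv_rev, h3,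
        one_mulVec, EuclideanSpace.real_norm_sq_eq]
      simp [dotProduct, sq]
    have h4 : √((2 * Real.pi) ^ n * S.det) = √((2 * Real.pi) ^ n) * |s.det| := by
      rw [Real.sqrt_mul (by positivity), ← hss, det_mul, Real.sqrt_mul_self_eq_abs]
    rw [gaussianDensity, h1, h2, h4, mul_inv]
    have := abs_pos.2 hdet
    field_simp
  have hm : Measurable fun x => ENNReal.ofReal (gaussianDensity μ S x) :=
    (measurable_gaussianDensity μ S).ennreal_ofReal
  have hm' : Measurable fun x => ENNReal.ofReal (gaussianDensity μ S (μ + A x)) := hm.comp hT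
  refine Measure.ext fun B hB => ?_
  rw [multivariateGaussian, stdGaussian_eq_withDensity, Measure.map_apply hT hB,
    withDensity_apply _ (hT hB), withDensity_apply _ hB]
  nth_rewrite 2 [hvol]
  rw [Measure.restrict_smul, lintegral_smul_measure, setLIntegral_map hB hm hT, smul_eq_mul,
    ← lintegral_const_mul _ hm']
  refine lintegral_congr fun x => ?_
  rw [← hdens, ENNReal.ofReal_mul (abs_nonneg _)]

/-- Characteristic functions are compared rather than densities, because a closed loop `K` may be
singular and the image degenerate. -/
lemma multivariateGaussian_map_affine (μ : EuclideanSpace ℝ (Fin n))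
    {S : Matrix (Fin n) (Fin n) ℝ} (hS : S.PosSemidef) (K : Matrix (Fin n) (Fin n) ℝ)
    (c : Fin n → ℝ) :
    (multivariateGaussian μ S).map (fun x => WithLp.toLp 2 (K *ᵥ x.ofLp + c)) =
      multivariateGaussian (WithLp.toLp 2 (K *ᵥ μ.ofLp + c)) (K * S * Kᵀ) := by
  have hm : Measurable fun x : EuclideanSpace ℝ (Fin n) => WithLp.toLp 2 (K *ᵥ x.ofLp + c) := by
    apply Continuous.measurable
    fun_prop
  have := Measure.isProbabilityMeasure_map (μ := multivariateGaussian μ S) hm.aemeasurable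
  refine Measure.ext_of_charFun ?_
  ext t
  have hinner : ∀ x : EuclideanSpace ℝ (Fin n), ⟪WithLp.toLp 2 (K *ᵥ x.ofLp + c), t⟫ =
      ⟪x, WithLp.toLp 2 (Kᵀ *ᵥ t.ofLp)⟫ + c ⬝ᵥ t.ofLp := by
    intro x
    simp only [EuclideanSpace.inner_eq_star_dotProduct, star_trivial]
    rw [dotProduct_add, dotProduct_comm _ c]
    congr 1
    rw [dotProduct_mulVec, ← mulVec_transpose, dotProduct_comm]
  rw [charFun_apply, integral_map hm.aemeasurable (by fun_prop),
    charFun_multivariateGaussian (posSemidef_mul_mul_transpose hS K)]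
  simp_rw [hinner]
  push_cast
  simp_rw [add_mul, Complex.exp_add]
  rw [integral_mul_const, ← charFun_apply, charFun_multivariateGaussian hS, ← Complex.exp_add]
  congr 1
  rw [real_inner_comm, real_inner_comm (WithLp.toLp 2 (K *ᵥ μ.ofLp + c)) t, hinner]
  have hq : (Kᵀ *ᵥ t.ofLp) ⬝ᵥ (S *ᵥ (Kᵀ *ᵥ t.ofLp)) = t.ofLp ⬝ᵥ ((K * S * Kᵀ) *ᵥ t.ofLp) := by
    rw [← mulVec_mulVec, ← mulVec_mulVec, dotProduct_mulVec t.ofLp, ← mulVec_transpose]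
  rw [hq]
  push_cast
  ring

variable {μ : EuclideanSpace ℝ (Fin n)} {S : Matrix (Fin n) (Fin n) ℝ}

lemma memLp_two_coord (a : Fin n) :
    MemLp (fun x : EuclideanSpace ℝ (Fin n) => x.ofLp a) 2 (multivariateGaussian μ S) := by
  have := IsGaussian.memLp_dual (multivariateGaussian μ S) (EuclideanSpace.proj a) 2 (by simp)
  simpa using this

lemma memLp_two_coord_sub (a : Fin n) :
    MemLp (fun x : EuclideanSpace ℝ (Fin n) => (x - μ).ofLp a) 2 (multivariateGaussian μ S) := by
  exact (memLp_two_coord a).sub (memLp_const (μ.ofLp a))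

lemma integral_coord (a : Fin n) :
    ∫ x, x.ofLp a ∂(multivariateGaussian μ S) = μ.ofLp a := by
  have h := (EuclideanSpace.proj (𝕜 := ℝ) a : EuclideanSpace ℝ (Fin n) →L[ℝ] ℝ).integral_comp_comm
    (μ := multivariateGaussian μ S) (φ := fun x => x) IsGaussian.integrable_fun_id
  rw [integral_id_multivariateGaussian] at h
  simpa using h

lemma integral_coord_sub (a : Fin n) :
    ∫ x, (x - μ).ofLp a ∂(multivariateGaussian μ S) = 0 := by
  have h : ∀ x : EuclideanSpace ℝ (Fin n), (x - μ).ofLp a = x.ofLp a - μ.ofLp a := fun x => rfl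
  simp_rw [h]
  rw [integral_sub ((memLp_two_coord a).integrable (by simp)) (integrable_const _), integral_coord]
  simp

lemma integrable_coord_sub_mul (a b : Fin n) :
    Integrable (fun x : EuclideanSpace ℝ (Fin n) => (x - μ).ofLp a * (x - μ).ofLp b)
      (multivariateGaussian μ S) :=
  (memLp_two_coord_sub a).integrable_mul (memLp_two_coord_sub b)

lemma integral_coord_sub_mul (hS : S.PosSemidef) (a b : Fin n) :
    ∫ x, (x - μ).ofLp a * (x - μ).ofLp b ∂(multivariateGaussian μ S) = S a b := by
  rw [← covariance_eval_multivariateGaussian (μ := μ) hS a b, covariance]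
  simp only [integral_coord]
  rfl

/-- The expectation of a quadratic polynomial under a Gaussian. -/
lemma integral_quadratic (hS : S.PosSemidef) (c : ℝ) (b : Fin n → ℝ)
    (W : Matrix (Fin n) (Fin n) ℝ) :
    Integrable (fun x : EuclideanSpace ℝ (Fin n) =>
      c + b ⬝ᵥ (x - μ).ofLp + (x - μ).ofLp ⬝ᵥ (W *ᵥ (x - μ).ofLp)) (multivariateGaussian μ S) ∧
    ∫ x, (c + b ⬝ᵥ (x - μ).ofLp + (x - μ).ofLp ⬝ᵥ (W *ᵥ (x - μ).ofLp))
      ∂(multivariateGaussian μ S) = c + (W * S).trace := by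
  have hlin : ∀ x : EuclideanSpace ℝ (Fin n), b ⬝ᵥ (x - μ).ofLp = ∑ a, b a * (x - μ).ofLp a :=
    fun x => rfl
  have hquad : ∀ x : EuclideanSpace ℝ (Fin n), (x - μ).ofLp ⬝ᵥ (W *ᵥ (x - μ).ofLp) =
      ∑ a, ∑ e, W a e * ((x - μ).ofLp a * (x - μ).ofLp e) := by
    intro x
    simp only [dotProduct, mulVec, Finset.mul_sum]
    exact Finset.sum_congr rfl fun a _ => Finset.sum_congr rfl fun e _ => by ring
  simp_rw [hlin, hquad]
  have i1 : ∀ a ∈ Finset.univ, Integrable (fun x : EuclideanSpace ℝ (Fin n) =>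
      b a * (x - μ).ofLp a) (multivariateGaussian μ S) :=
    fun a _ => ((memLp_two_coord_sub a).integrable (by simp)).const_mul _
  have i2 : ∀ a e, Integrable (fun x : EuclideanSpace ℝ (Fin n) =>
      W a e * ((x - μ).ofLp a * (x - μ).ofLp e)) (multivariateGaussian μ S) :=
    fun a e => (integrable_coord_sub_mul a e).const_mul _
  have i3 : ∀ a ∈ Finset.univ, Integrable (fun x : EuclideanSpace ℝ (Fin n) =>
      ∑ e, W a e * ((x - μ).ofLp a * (x - μ).ofLp e)) (multivariateGaussian μ S) :=
    fun a _ => integrable_finsetSum _ fun e _ => i2 a e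
  have i4 := integrable_finsetSum Finset.univ i1
  have i5 := integrable_finsetSum Finset.univ i3
  have i6 : Integrable (fun x : EuclideanSpace ℝ (Fin n) => c + ∑ a, b a * (x - μ).ofLp a)
      (multivariateGaussian μ S) := (integrable_const c).add i4
  refine ⟨i6.add i5, ?_⟩
  rw [integral_add i6 i5, integral_add (integrable_const _) i4, integral_finsetSum _ i1,
    integral_finsetSum _ i3]
  simp_rw [integral_const_mul, integral_coord_sub]
  have h : ∀ a, ∫ x : EuclideanSpace ℝ (Fin n), ∑ e, W a e * ((x - μ).ofLp a * (x - μ).ofLp e)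
      ∂(multivariateGaussian μ S) = ∑ e, W a e * S a e := by
    intro a
    rw [integral_finsetSum _ fun e _ => i2 a e]
    simp_rw [integral_const_mul, integral_coord_sub_mul hS]
  have hST := transpose_eq_of_posSemidef hS
  simp only [h, integral_const, probReal_univ, one_smul, mul_zero, Finset.sum_const_zero, add_zero,
    trace, diag_apply, mul_apply]
  congr 1
  refine Finset.sum_congr rfl fun a _ => Finset.sum_congr rfl fun e _ => ?_
  rw [← congrFun (congrFun hST e) a, transpose_apply]

end Gaussian

/-! ## The laws induced by a policy -/

section Policy

open scoped ENNReal

variable {n m N r q : ℕ}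

lemma mixtureDensity_pos {G : GMM n r} (hG : G.IsNondegenerate) (x : EuclideanSpace ℝ (Fin n)) :
    0 < ∑ i, G.weight i * gaussianDensity (G.mean i) (G.cov i) x := by
  obtain ⟨h0, h1⟩ := hG.weight_mem
  have hpos : ∃ i ∈ Finset.univ, 0 < G.weight i := by
    by_contra! h
    have : ∑ i, G.weight i ≤ 0 := Finset.sum_nonpos h
    linarith
  obtain ⟨i, hi, hpi⟩ := hpos
  exact Finset.sum_pos' (fun i _ => mul_nonneg (h0 i) (gaussianDensity_pos (hG.cov_posDef i) x).le)
    ⟨i, hi, mul_pos hpi (gaussianDensity_pos (hG.cov_posDef i) x)⟩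

lemma likelihood_nonneg {G : GMM n r} (hG : G.IsNondegenerate) (i : Fin r)
    (x : EuclideanSpace ℝ (Fin n)) : 0 ≤ G.likelihood i x :=
  div_nonneg (mul_nonneg (hG.weight_mem.1 i) (gaussianDensity_pos (hG.cov_posDef i) x).le)
    (mixtureDensity_pos hG x).le

lemma sum_likelihood {G : GMM n r} (hG : G.IsNondegenerate) (x : EuclideanSpace ℝ (Fin n)) :
    ∑ i, G.likelihood i x = 1 := by
  simp only [GMM.likelihood]
  rw [← Finset.sum_div, div_self (mixtureDensity_pos hG x).ne']

lemma law_eq_withDensity {G : GMM n r} (hG : G.IsNondegenerate) :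
    G.law = (volume : Measure (EuclideanSpace ℝ (Fin n))).withDensity fun x =>
      ENNReal.ofReal (∑ i, G.weight i * gaussianDensity (G.mean i) (G.cov i) x) := by
  refine Measure.ext fun B hB => ?_
  rw [GMM.law, Measure.coe_finsetSum, Finset.sum_apply, withDensity_apply _ hB]
  have h : ∀ x, ENNReal.ofReal (∑ i, G.weight i * gaussianDensity (G.mean i) (G.cov i) x) =
      ∑ i, ENNReal.ofReal (G.weight i) * ENNReal.ofReal (gaussianDensity (G.mean i) (G.cov i) x) := by
    intro x
    rw [ENNReal.ofReal_sum_of_nonneg fun i _ =>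
      mul_nonneg (hG.weight_mem.1 i) (gaussianDensity_pos (hG.cov_posDef i) x).le]
    exact Finset.sum_congr rfl fun i _ => ENNReal.ofReal_mul (hG.weight_mem.1 i)
  simp_rw [h]
  rw [lintegral_finsetSum _ fun i _ =>
    (measurable_gaussianDensity (G.mean i) (G.cov i)).ennreal_ofReal.const_mul _]
  refine Finset.sum_congr rfl fun i _ => ?_
  rw [lintegral_const_mul _ (measurable_gaussianDensity (G.mean i) (G.cov i)).ennreal_ofReal,
    Measure.smul_apply, smul_eq_mul, multivariateGaussian_eq_withDensity _ (hG.cov_posDef i),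
    withDensity_apply _ hB]

/-- Reweighting a mixture by a posterior probability recovers the component. -/
lemma law_withDensity_likelihood {G : GMM n r} (hG : G.IsNondegenerate) (i : Fin r) :
    G.law.withDensity (fun x => ENNReal.ofReal (G.likelihood i x)) =
      ENNReal.ofReal (G.weight i) • multivariateGaussian (G.mean i) (G.cov i) := by
  have hm : Measurable fun x =>
      ENNReal.ofReal (∑ i, G.weight i * gaussianDensity (G.mean i) (G.cov i) x) := by
    refine Measurable.ennreal_ofReal (Finset.measurable_sum _ fun i _ => ?_)
    exact (measurable_gaussianDensity _ _).const_mul _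
  rw [law_eq_withDensity hG, ← withDensity_mul _ hm (measurable_likelihood G i).ennreal_ofReal,
    multivariateGaussian_eq_withDensity _ (hG.cov_posDef i),
    ← withDensity_smul _ (measurable_gaussianDensity _ _).ennreal_ofReal]
  congr 1
  funext x
  rw [Pi.mul_apply, Pi.smul_apply, smul_eq_mul, ← ENNReal.ofReal_mul (mixtureDensity_pos hG x).le,
    ← ENNReal.ofReal_mul (hG.weight_mem.1 i), GMM.likelihood,
    mul_div_cancel₀ _ (mixtureDensity_pos hG x).ne']

lemma isProbabilityMeasure_law {G : GMM n r} (hG : G.weight ∈ stdSimplex ℝ (Fin r)) :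
    IsProbabilityMeasure G.law := by
  constructor
  rw [GMM.law, Measure.coe_finsetSum, Finset.sum_apply]
  simp only [Measure.smul_apply, measure_univ, smul_eq_mul, mul_one]
  rw [← ENNReal.ofReal_sum_of_nonneg fun i _ => hG.1 i, hG.2, ENNReal.ofReal_one]

variable {init : GMM n r} {pol : PolicyParams n m N r q}

lemma isMarkovKernel_kernel (hinit : init.IsNondegenerate) (hpol : pol.IsAdmissible) :
    IsMarkovKernel (pol.kernel init) := by
  refine ⟨fun x => ⟨?_⟩⟩
  change (∑ i, ∑ j, ENNReal.ofReal (pol.weight i j * init.likelihood i x) •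
    Measure.dirac (pol.gain i j *ᵥ (x - init.mean i).ofLp + pol.feedforward i j)) Set.univ = 1
  simp only [Measure.coe_finsetSum, Finset.sum_apply, Measure.smul_apply, measure_univ,
    smul_eq_mul, mul_one]
  have h : ∀ i, ∑ j, ENNReal.ofReal (pol.weight i j * init.likelihood i x) =
      ENNReal.ofReal (init.likelihood i x) := by
    intro i
    rw [← ENNReal.ofReal_sum_of_nonneg fun j _ =>
      mul_nonneg ((hpol i).1 j) (likelihood_nonneg hinit i x), ← Finset.sum_mul, (hpol i).2, one_mul]
  simp_rw [h]
  rw [← ENNReal.ofReal_sum_of_nonneg fun i _ => likelihood_nonneg hinit i x,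
    sum_likelihood hinit, ENNReal.ofReal_one]

/-- The graph of the `(i, j)`-th feedback law. -/
def feedbackGraph (pol : PolicyParams n m N r q) (init : GMM n r) (i : Fin r) (j : Fin q)
    (x : EuclideanSpace ℝ (Fin n)) : EuclideanSpace ℝ (Fin n) × ControlSeq m N :=
  (x, pol.gain i j *ᵥ (x - init.mean i).ofLp + pol.feedforward i j)

lemma continuous_feedbackGraph (i : Fin r) (j : Fin q) :
    Continuous (feedbackGraph pol init i j) := by
  unfold feedbackGraph
  fun_prop

/-- The joint law of the initial state and the controls is a mixture of the laws of the
component feedback laws. -/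
lemma jointLaw_eq_sum (hinit : init.IsNondegenerate) (hpol : pol.IsAdmissible) :
    pol.jointLaw init = ∑ i, ∑ j, ENNReal.ofReal (init.weight i * pol.weight i j) •
      (multivariateGaussian (init.mean i) (init.cov i)).map (feedbackGraph pol init i j) := by
  have := isMarkovKernel_kernel hinit hpol
  have := isProbabilityMeasure_law hinit.weight_mem
  refine Measure.ext fun s hs => ?_
  have hmeas : ∀ i j, MeasurableSet (feedbackGraph pol init i j ⁻¹' s) :=
    fun i j => (continuous_feedbackGraph i j).measurable hs
  have hpt : ∀ x, pol.kernel init x (Prod.mk x ⁻¹' s) = ∑ i, ∑ j,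
      ENNReal.ofReal (pol.weight i j) * (ENNReal.ofReal (init.likelihood i x) *
        (feedbackGraph pol init i j ⁻¹' s).indicator 1 x) := by
    intro x
    change (∑ i, ∑ j, ENNReal.ofReal (pol.weight i j * init.likelihood i x) •
      Measure.dirac (pol.gain i j *ᵥ (x - init.mean i).ofLp + pol.feedforward i j))
        (Prod.mk x ⁻¹' s) = _
    simp only [Measure.coe_finsetSum, Finset.sum_apply, Measure.smul_apply, smul_eq_mul]
    refine Finset.sum_congr rfl fun i _ => Finset.sum_congr rfl fun j _ => ?_
    rw [Measure.dirac_apply' _ (measurable_prodMk_left hs), ENNReal.ofReal_mul ((hpol i).1 j),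
      mul_assoc]
    rfl
  rw [PolicyParams.jointLaw, Measure.compProd_apply hs]
  simp_rw [hpt]
  have hmi : ∀ i j, Measurable fun x => ENNReal.ofReal (init.likelihood i x) *
      (feedbackGraph pol init i j ⁻¹' s).indicator (1 : EuclideanSpace ℝ (Fin n) → ℝ≥0∞) x := fun i j =>
    (measurable_likelihood init i).ennreal_ofReal.mul (measurable_one.indicator (hmeas i j))
  rw [lintegral_finsetSum _ fun i _ => Finset.measurable_sum _ fun j _ => (hmi i j).const_mul _]
  rw [Measure.coe_finsetSum, Finset.sum_apply]
  refine Finset.sum_congr rfl fun i _ => ?_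
  rw [lintegral_finsetSum _ fun j _ => (hmi i j).const_mul _, Measure.coe_finsetSum,
    Finset.sum_apply]
  refine Finset.sum_congr rfl fun j _ => ?_
  rw [lintegral_const_mul _ (hmi i j), Measure.smul_apply, smul_eq_mul,
    Measure.map_apply (continuous_feedbackGraph i j).measurable hs,
    ENNReal.ofReal_mul (hinit.weight_mem.1 i), mul_comm (ENNReal.ofReal (init.weight i)), mul_assoc]
  congr 1
  -- The posterior weight turns the integral over the mixture into one over the `i`-th component
  -- alone.
  have h := congrArg (fun ν : Measure _ => ν (feedbackGraph pol init i j ⁻¹' s))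
    (law_withDensity_likelihood hinit i)
  simp only [withDensity_apply _ (hmeas i j), Measure.smul_apply, smul_eq_mul] at h
  rw [← h, ← lintegral_indicator (hmeas i j)]
  refine lintegral_congr fun x => ?_
  by_cases hx : x ∈ feedbackGraph pol init i j ⁻¹' s <;> simp [hx]

lemma map_sum_smul {ι α β : Type*} [MeasurableSpace α] [MeasurableSpace β] (s : Finset ι)
    (c : ι → ℝ≥0∞) (ν : ι → Measure α) {f : α → β} (hf : Measurable f) :
    (∑ i ∈ s, c i • ν i).map f = ∑ i ∈ s, c i • (ν i).map f := by
  refine Measure.ext fun B hB => ?_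
  simp [Measure.map_apply hf hB]

/-- The mean to which the `(i, j)`-th feedback law steers. -/
def terminalMean (sys : LinearSystem n m N) (init : GMM n r) (pol : PolicyParams n m N r q)
    (i : Fin r) (j : Fin q) : EuclideanSpace ℝ (Fin n) :=
  WithLp.toLp 2 (sys.PhiN *ᵥ (init.mean i).ofLp + sys.BN *ᵥ pol.feedforward i j)

/-- The covariance to which the `(i, j)`-th feedback law steers. -/
def terminalCov (sys : LinearSystem n m N) (init : GMM n r) (pol : PolicyParams n m N r q)
    (i : Fin r) (j : Fin q) : Matrix (Fin n) (Fin n) ℝ :=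
  (sys.PhiN + sys.BN * pol.gain i j) * init.cov i * (sys.PhiN + sys.BN * pol.gain i j)ᵀ

lemma terminalLaw_eq_sum (sys : LinearSystem n m N) (hinit : init.IsNondegenerate)
    (hpol : pol.IsAdmissible) :
    pol.terminalLaw sys init = ∑ i, ∑ j, ENNReal.ofReal (init.weight i * pol.weight i j) •
      multivariateGaussian (terminalMean sys init pol i j) (terminalCov sys init pol i j) := by
  have hm : Measurable fun z : EuclideanSpace ℝ (Fin n) × ControlSeq m N =>
      WithLp.toLp 2 (sys.trajectory z.1.ofLp z.2 (Fin.last N)) := by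
    simp_rw [trajectory_last]
    apply Continuous.measurable
    fun_prop
  rw [PolicyParams.terminalLaw, jointLaw_eq_sum hinit hpol, ← Fintype.sum_prod_type',
    ← Fintype.sum_prod_type', map_sum_smul _ _ _ hm]
  refine Finset.sum_congr rfl fun ij _ => ?_
  obtain ⟨i, j⟩ := ij
  congr 1
  rw [Measure.map_map hm (continuous_feedbackGraph i j).measurable]
  -- Along one branch the terminal state is an affine function of the initial state with linear part
  -- `Φ + 𝐁 𝐋ᵢⱼ`.
  have hcomp : (fun z : EuclideanSpace ℝ (Fin n) × ControlSeq m N =>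
      WithLp.toLp 2 (sys.trajectory z.1.ofLp z.2 (Fin.last N))) ∘ feedbackGraph pol init i j =
      fun x => WithLp.toLp 2 ((sys.PhiN + sys.BN * pol.gain i j) *ᵥ x.ofLp +
        (sys.BN *ᵥ pol.feedforward i j - (sys.BN * pol.gain i j) *ᵥ (init.mean i).ofLp)) := by
    funext x
    simp only [Function.comp_apply, feedbackGraph, trajectory_last]
    congr 1
    rw [mulVec_add, mulVec_mulVec, WithLp.ofLp_sub, mulVec_sub, add_mulVec]
    abel
  rw [hcomp, multivariateGaussian_map_affine _ (hinit.cov_posDef i).posSemidef, terminalCov,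
    terminalMean]
  congr 2
  rw [add_mulVec]
  abel

/-- The expected cost is the mixture of the component costs. -/
lemma integral_realizedCost (sys : LinearSystem n m N) {cost : QuadraticCost n m N}
    (hR : ∀ k, (cost.R k).PosDef) (hQ : ∀ k, (cost.Q k).PosSemidef)
    (hinit : init.IsNondegenerate) (hpol : pol.IsAdmissible) :
    Integrable (realizedCost sys cost) (pol.jointLaw init) ∧
      ∫ z, realizedCost sys cost z ∂(pol.jointLaw init) = ∑ i, ∑ j,
        init.weight i * pol.weight i j * (meanCost sys cost (init.mean i) (pol.feedforward i j) +
          covCost sys cost (init.cov i) (pol.gain i j)) := by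
  have hcont : Continuous (realizedCost sys cost) := by
    have : realizedCost sys cost = fun z => meanCost sys cost z.1 z.2 :=
      funext fun z => realizedCost_eq_meanCost sys cost z
    rw [this]
    unfold meanCost
    fun_prop
  have hcomp : ∀ i j, Integrable (realizedCost sys cost)
      ((multivariateGaussian (init.mean i) (init.cov i)).map (feedbackGraph pol init i j)) ∧
      ∫ z, realizedCost sys cost z
        ∂((multivariateGaussian (init.mean i) (init.cov i)).map (feedbackGraph pol init i j)) =
      meanCost sys cost (init.mean i) (pol.feedforward i j) +
          covCost sys cost (init.cov i) (pol.gain i j) := by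
    intro i j
    obtain ⟨b, hb⟩ := meanCost_feedback sys hR hQ (init.mean i) (pol.gain i j)
      (pol.feedforward i j)
    have hg := (continuous_feedbackGraph (pol := pol) (init := init) i j).measurable.aemeasurable
      (μ := multivariateGaussian (init.mean i) (init.cov i))
    have hfun : realizedCost sys cost ∘ feedbackGraph pol init i j = _ := funext fun x =>
      (realizedCost_eq_meanCost sys cost (feedbackGraph pol init i j x)).trans (hb x)
    have hq := integral_quadratic (μ := init.mean i) (hinit.cov_posDef i).posSemidef
      (meanCost sys cost (init.mean i) (pol.feedforward i j)) b
      ((pol.gain i j)ᵀ * cost.bigR * pol.gain i j + (sys.Gam + sys.Hu * pol.gain i j)ᵀ *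
        cost.bigQ * (sys.Gam + sys.Hu * pol.gain i j))
    constructor
    · rw [integrable_map_measure hcont.aestronglyMeasurable hg, hfun]
      exact hq.1
    · rw [integral_map hg hcont.aestronglyMeasurable]
      have hfun' : ∀ x, realizedCost sys cost (feedbackGraph pol init i j x) = _ := congrFun hfun
      simp_rw [hfun']
      rw [hq.2]
      congr 1
      rw [covCost, Matrix.add_mul, trace_add]
      congr 1
      · conv_rhs => rw [trace_mul_comm]
        simp only [Matrix.mul_assoc]
      · conv_rhs => rw [trace_mul_comm]
        simp only [Matrix.mul_assoc]
  have hw : ∀ i j, 0 ≤ init.weight i * pol.weight i j := fun i j =>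
    mul_nonneg (hinit.weight_mem.1 i) ((hpol i).1 j)
  have hint : ∀ i j, Integrable (realizedCost sys cost)
      (ENNReal.ofReal (init.weight i * pol.weight i j) •
        (multivariateGaussian (init.mean i) (init.cov i)).map (feedbackGraph pol init i j)) :=
    fun i j => (hcomp i j).1.smul_measure ENNReal.ofReal_ne_top
  rw [jointLaw_eq_sum hinit hpol]
  constructor
  · exact integrable_finsetSum_measure.2 fun i _ => integrable_finsetSum_measure.2 fun j _ =>
      hint i j
  · rw [integral_finsetSum_measure fun i _ => integrable_finsetSum_measure.2 fun j _ => hint i j]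
    refine Finset.sum_congr rfl fun i _ => ?_
    rw [integral_finsetSum_measure fun j _ => hint i j]
    refine Finset.sum_congr rfl fun j _ => ?_
    rw [integral_smul_measure, (hcomp i j).2, ENNReal.toReal_ofReal (hw i j), smul_eq_mul]

end Policy

/-! ## Identifiability of Gaussian mixtures -/

section Identifiability

open scoped RealInnerProductSpace ENNReal

lemma tendsto_exp_quadratic {a b : ℝ} (h : b < 0 ∨ b = 0 ∧ a < 0) :
    Filter.Tendsto (fun s : ℝ => Real.exp (s * a + s ^ 2 * b)) Filter.atTop (nhds 0) := by
  refine Real.tendsto_exp_atBot.comp ?_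
  have heq : (fun s : ℝ => s * a + s ^ 2 * b) = fun s => s * (a + s * b) := by
    funext s; ring
  rw [heq]
  rcases h with h | ⟨h, h'⟩
  · refine Filter.Tendsto.atTop_mul_atBot₀ Filter.tendsto_id ?_
    exact Filter.tendsto_atBot_add_const_left _ _ (Filter.tendsto_id.atTop_mul_const_of_neg h)
  · subst h
    simpa using Filter.tendsto_id.atTop_mul_const_of_neg h'

/-- Exponentials of distinct quadratic polynomials without constant term are linearly
independent. -/
lemma coeff_eq_zero_of_sum_exp_quadratic (F : Finset (ℝ ×ₗ ℝ)) (c : ℝ ×ₗ ℝ → ℝ)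
    (h : ∀ s : ℝ, ∑ p ∈ F, c p * Real.exp (s * (ofLex p).2 + s ^ 2 * (ofLex p).1) = 0) :
    ∀ p ∈ F, c p = 0 := by
  induction F using Finset.induction_on_max with
  | empty => simp
  | insert m F hm ih =>
    have hmF : m ∉ F := fun hmem => lt_irrefl _ (hm m hmem)
    -- Dividing by the lexicographically largest exponential, the one that dominates as `s → ∞`,
    -- sends all other terms to zero and leaves its coefficient.
    have hdiv : ∀ s : ℝ, c m + ∑ p ∈ F, c p * Real.exp (s * ((ofLex p).2 - (ofLex m).2) +
        s ^ 2 * ((ofLex p).1 - (ofLex m).1)) = 0 := by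
      intro s
      have h1 := h s
      rw [Finset.sum_insert hmF] at h1
      have h2 : ∀ p : ℝ ×ₗ ℝ, c p * Real.exp (s * ((ofLex p).2 - (ofLex m).2) +
          s ^ 2 * ((ofLex p).1 - (ofLex m).1)) =
          c p * Real.exp (s * (ofLex p).2 + s ^ 2 * (ofLex p).1) *
            Real.exp (-(s * (ofLex m).2 + s ^ 2 * (ofLex m).1)) := by
        intro p
        rw [mul_assoc, ← Real.exp_add]
        congr 2
        ring
      simp_rw [h2]
      rw [← Finset.sum_mul, eq_neg_of_add_eq_zero_right h1, neg_mul, mul_assoc, ← Real.exp_add]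
      simp
    have hlim : Filter.Tendsto (fun s : ℝ => c m + ∑ p ∈ F, c p *
        Real.exp (s * ((ofLex p).2 - (ofLex m).2) + s ^ 2 * ((ofLex p).1 - (ofLex m).1)))
        Filter.atTop (nhds (c m + ∑ p ∈ F, c p * 0)) := by
      refine tendsto_const_nhds.add (tendsto_finsetSum _ fun p hp => ?_)
      refine (tendsto_exp_quadratic ?_).const_mul _
      have := hm p hp
      rw [Prod.Lex.lt_iff] at this
      rcases this with h1 | ⟨h1, h2⟩
      · exact Or.inl (sub_neg.2 h1)
      · exact Or.inr ⟨sub_eq_zero.2 h1, sub_neg.2 h2⟩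
    simp_rw [hdiv] at hlim
    have hcm : c m = 0 := by
      have := tendsto_nhds_unique hlim tendsto_const_nhds
      simpa using this
    have hF : ∀ s : ℝ, ∑ p ∈ F, c p * Real.exp (s * (ofLex p).2 + s ^ 2 * (ofLex p).1) = 0 := by
      intro s
      have := h s
      rwa [Finset.sum_insert hmF, hcm, zero_mul, zero_add] at this
    intro p hp
    rcases Finset.mem_insert.1 hp with rfl | hp
    · exact hcm
    · exact ih hF p hp

-- Indices with equal exponents are collected first, so that the linear independence of distinct
-- exponentials applies to the sums over fibres.
open Classical in
lemma fiber_sum_eq_zero_of_sum_exp_quadratic {κ : Type*} [Fintype κ] (c : κ → ℝ)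
    (g : κ → ℝ ×ₗ ℝ)
    (h : ∀ s : ℝ, ∑ k, c k * Real.exp (s * (ofLex (g k)).2 + s ^ 2 * (ofLex (g k)).1) = 0)
    (p : ℝ ×ₗ ℝ) : ∑ k, (if g k = p then c k else 0) = 0 := by
  by_cases hp : p ∈ Finset.univ.image g
  · refine coeff_eq_zero_of_sum_exp_quadratic (Finset.univ.image g)
      (fun p => ∑ k, if g k = p then c k else 0) (fun s => ?_) p hp
    refine Eq.trans ?_ (h s)
    simp_rw [Finset.sum_mul]
    rw [Finset.sum_comm]
    refine Finset.sum_congr rfl fun k _ => ?_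
    rw [Finset.sum_eq_single_of_mem (g k) (Finset.mem_image_of_mem g (Finset.mem_univ k))]
    · rw [if_pos rfl]
    · intro b _ hb
      rw [if_neg hb.symm, zero_mul]
  · refine Finset.sum_eq_zero fun k _ => if_neg fun hk => hp ?_
    rw [← hk]
    exact Finset.mem_image_of_mem g (Finset.mem_univ k)

/-- Finitely many nonzero polynomials have a common point where none vanishes. -/
lemma exists_forall_eval_ne_zero {σ ι : Type*} (s : Finset ι) (P : ι → MvPolynomial σ ℝ)
    (hP : ∀ i ∈ s, P i ≠ 0) : ∃ t : σ → ℝ, ∀ i ∈ s, MvPolynomial.eval t (P i) ≠ 0 := by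
  have hprod : ∏ i ∈ s, P i ≠ 0 := Finset.prod_ne_zero_iff.2 hP
  by_contra! h
  refine hprod (MvPolynomial.funext fun t => ?_)
  obtain ⟨i, hi, hi0⟩ := h t
  rw [map_prod, map_zero]
  exact Finset.prod_eq_zero hi hi0

variable {n : ℕ}

lemma eq_zero_of_quadratic_eq_zero {A : Matrix (Fin n) (Fin n) ℝ} (hA : Aᵀ = A)
    (h : ∀ t : Fin n → ℝ, t ⬝ᵥ (A *ᵥ t) = 0) : A = 0 := by
  have h1 : ∀ u v : Fin n → ℝ, v ⬝ᵥ (A *ᵥ u) = 0 := by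
    intro u v
    have := dotProduct_mulVec_add hA u v
    rw [h, h, h] at this
    linarith
  ext a b
  have := h1 (Pi.single b 1) (Pi.single a 1)
  simpa using this

/-- A direction that separates finitely many pairs of means and covariances. -/
lemma exists_separating_direction {ι : Type*} (s : Finset ι) (v : ι → Fin n → ℝ)
    (A : ι → Matrix (Fin n) (Fin n) ℝ) (hA : ∀ i ∈ s, (A i)ᵀ = A i)
    (hne : ∀ i ∈ s, v i ≠ 0 ∨ A i ≠ 0) :
    ∃ t : Fin n → ℝ, ∀ i ∈ s, t ⬝ᵥ v i ≠ 0 ∨ t ⬝ᵥ (A i *ᵥ t) ≠ 0 := by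
  -- As a sum of two squares, this polynomial vanishes at `t` exactly when neither the linear nor
  -- the quadratic form separates there. It is not identically zero, since the vector or the
  -- symmetric matrix is nonzero.
  let P : ι → MvPolynomial (Fin n) ℝ := fun i =>
    (∑ a, MvPolynomial.X a * MvPolynomial.C (v i a)) ^ 2 +
      (∑ a, MvPolynomial.X a * ∑ b, MvPolynomial.C (A i a b) * MvPolynomial.X b) ^ 2
  have heval : ∀ i t, MvPolynomial.eval t (P i) =
      (t ⬝ᵥ v i) ^ 2 + (t ⬝ᵥ (A i *ᵥ t)) ^ 2 := by
    intro i t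
    simp [P, dotProduct, mulVec]
  obtain ⟨t, ht⟩ := exists_forall_eval_ne_zero s P (by
    intro i hi h0
    have hz : ∀ t, (t ⬝ᵥ v i) ^ 2 + (t ⬝ᵥ (A i *ᵥ t)) ^ 2 = 0 := by
      intro t
      rw [← heval, h0, map_zero]
    have hz' : ∀ t, t ⬝ᵥ v i = 0 ∧ t ⬝ᵥ (A i *ᵥ t) = 0 := by
      intro t
      have := hz t
      constructor <;> nlinarith [sq_nonneg (t ⬝ᵥ v i), sq_nonneg (t ⬝ᵥ (A i *ᵥ t))]
    rcases hne i hi with h | h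
    · exact h (dotProduct_self_eq_zero.1 (hz' (v i)).1)
    · exact h (eq_zero_of_quadratic_eq_zero (hA i hi) fun t => (hz' t).2))
  refine ⟨t, fun i hi => ?_⟩
  by_contra! hcon
  exact ht i hi (by rw [heval, hcon.1, hcon.2]; ring)

/-- The projection on `t` is a one-dimensional Gaussian, so its moment generating function applies.
This holds for singular `S` too, which is why identifiability is proved through exponential moments.
-/
lemma integral_exp_multivariateGaussian (μ : EuclideanSpace ℝ (Fin n))
    {S : Matrix (Fin n) (Fin n) ℝ} (hS : S.PosSemidef) (t : Fin n → ℝ) (s : ℝ) :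
    Integrable (fun x : EuclideanSpace ℝ (Fin n) => Real.exp (s * (t ⬝ᵥ x.ofLp)))
      (multivariateGaussian μ S) ∧
    ∫ x, Real.exp (s * (t ⬝ᵥ x.ofLp)) ∂(multivariateGaussian μ S) =
      Real.exp (s * (t ⬝ᵥ μ.ofLp) + s ^ 2 * (t ⬝ᵥ (S *ᵥ t) / 2)) := by
  set L : StrongDual ℝ (EuclideanSpace ℝ (Fin n)) := innerSL ℝ (WithLp.toLp 2 t) with hL
  have hLx : ∀ x, L x = t ⬝ᵥ x.ofLp := by
    intro x
    rw [hL, innerSL_apply_apply, EuclideanSpace.inner_eq_star_dotProduct, dotProduct_comm]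
    simp
  have hmap := IsGaussian.map_eq_gaussianReal (μ := multivariateGaussian μ S) L
  have hmean : ∫ x, L x ∂(multivariateGaussian μ S) = t ⬝ᵥ μ.ofLp := by
    have := L.integral_comp_comm (μ := multivariateGaussian μ S) (φ := fun x => x)
      IsGaussian.integrable_fun_id
    rw [this, integral_id_multivariateGaussian, hLx]
  have hvar : Var[L; multivariateGaussian μ S] = t ⬝ᵥ (S *ᵥ t) := by
    have h1 := covarianceBilin_multivariateGaussian (μ := μ) hS (WithLp.toLp 2 t) (WithLp.toLp 2 t)
    rw [covarianceBilin_self IsGaussian.memLp_two_id] at h1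
    exact h1
  have hmgf := mgf_gaussianReal hmap s
  have hint : Integrable (fun x => Real.exp (s * L x)) (multivariateGaussian μ S) := by
    have h1 := integrable_exp_mul_gaussianReal (μ := ∫ x, L x ∂(multivariateGaussian μ S))
      (v := Var[L; multivariateGaussian μ S].toNNReal) s
    rw [← hmap] at h1
    exact h1.comp_measurable (by fun_prop)
  have hfun : (fun x : EuclideanSpace ℝ (Fin n) => Real.exp (s * (t ⬝ᵥ x.ofLp))) =
      fun x => Real.exp (s * L x) := by simp_rw [hLx]
  rw [hfun]
  refine ⟨hint, ?_⟩
  change mgf L (multivariateGaussian μ S) s = _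
  rw [hmgf, hmean, hvar, Real.coe_toNNReal _ (dotProduct_mulVec_self_nonneg hS t)]
  congr 1
  ring

lemma integral_exp_mixture {κ : Type*} [Fintype κ] {w : κ → ℝ} (hw : ∀ a, 0 ≤ w a)
    {θ : κ → EuclideanSpace ℝ (Fin n) × Matrix (Fin n) (Fin n) ℝ}
    (hθ : ∀ a, (θ a).2.PosSemidef) (t : Fin n → ℝ) (s : ℝ) :
    ∫ x, Real.exp (s * (t ⬝ᵥ x.ofLp))
      ∂(∑ a, ENNReal.ofReal (w a) • multivariateGaussian (θ a).1 (θ a).2) =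
    ∑ a, w a * Real.exp (s * (t ⬝ᵥ (θ a).1.ofLp) + s ^ 2 * (t ⬝ᵥ ((θ a).2 *ᵥ t) / 2)) := by
  rw [integral_finsetSum_measure fun a _ =>
    (integral_exp_multivariateGaussian _ (hθ a) t s).1.smul_measure ENNReal.ofReal_ne_top]
  refine Finset.sum_congr rfl fun a _ => ?_
  rw [integral_smul_measure, (integral_exp_multivariateGaussian _ (hθ a) t s).2,
    ENNReal.toReal_ofReal (hw a), smul_eq_mul]

open Classical in
/-- Two finite Gaussian mixtures (possibly with degenerate or repeated components) with the same law
give the same total weight to every pair of parameters. -/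
lemma fiber_weight_eq_of_mixture_eq {α β : Type*} [Fintype α] [Fintype β] {w : α → ℝ} {p : β → ℝ}
    (hw : ∀ a, 0 ≤ w a) (hp : ∀ b, 0 ≤ p b)
    {θ : α → EuclideanSpace ℝ (Fin n) × Matrix (Fin n) (Fin n) ℝ}
    {η : β → EuclideanSpace ℝ (Fin n) × Matrix (Fin n) (Fin n) ℝ}
    (hθ : ∀ a, (θ a).2.PosSemidef) (hη : ∀ b, (η b).2.PosSemidef)
    (h : ∑ a, ENNReal.ofReal (w a) • multivariateGaussian (θ a).1 (θ a).2 =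
      ∑ b, ENNReal.ofReal (p b) • multivariateGaussian (η b).1 (η b).2)
    (b₀ : β) :
    ∑ a, (if θ a = η b₀ then w a else 0) = ∑ b, if η b = η b₀ then p b else 0 := by
  have hint₁ := integral_exp_mixture hw hθ
  have hint₂ := integral_exp_mixture hp hη
  -- The difference of the mixtures is treated as one signed family. A direction `t` that separates
  -- all its distinct parameters reduces the claim to exponentials of one variable.
  let τ : α ⊕ β → EuclideanSpace ℝ (Fin n) × Matrix (Fin n) (Fin n) ℝ := Sum.elim θ η
  let c : α ⊕ β → ℝ := Sum.elim w fun b => -p b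
  have hτ : ∀ k, (τ k).2.PosSemidef := by rintro (a | b); exacts [hθ a, hη b]
  obtain ⟨t, ht⟩ := exists_separating_direction
    (Finset.univ.filter fun kl : (α ⊕ β) × (α ⊕ β) => τ kl.1 ≠ τ kl.2)
    (fun kl => (τ kl.1).1.ofLp - (τ kl.2).1.ofLp) (fun kl => (τ kl.1).2 - (τ kl.2).2)
    (fun kl _ => by
      rw [transpose_sub, transpose_eq_of_posSemidef (hτ _), transpose_eq_of_posSemidef (hτ _)])
    (fun kl hkl => by
      have hne := (Finset.mem_filter.1 hkl).2
      by_contra! hcon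
      refine hne (Prod.ext ?_ (sub_eq_zero.1 hcon.2))
      exact WithLp.ofLp_injective 2 (sub_eq_zero.1 hcon.1))
  -- The quadratic coefficient comes first, so that the lexicographic order is the order of growth.
  let g : α ⊕ β → ℝ ×ₗ ℝ := fun k =>
    toLex (t ⬝ᵥ ((τ k).2 *ᵥ t) / 2, t ⬝ᵥ (τ k).1.ofLp)
  have hg : ∀ k l, g k = g l ↔ τ k = τ l := by
    intro k l
    refine ⟨fun hkl => ?_, fun hkl => by simp only [g, hkl]⟩
    by_contra hne
    have h1 := ht (k, l) (Finset.mem_filter.2 ⟨Finset.mem_univ _, hne⟩)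
    have h2 := Prod.ext_iff.1 (toLex.injective hkl)
    simp only [dotProduct_sub, sub_mulVec] at h1 h2
    rcases h1 with h1 | h1
    · exact h1 (by linarith [h2.2])
    · exact h1 (by linarith [h2.1])
  have hzero : ∀ s : ℝ,
      ∑ k, c k * Real.exp (s * (ofLex (g k)).2 + s ^ 2 * (ofLex (g k)).1) = 0 := by
    intro s
    have h1 := hint₁ t s
    rw [h, hint₂ t s] at h1
    rw [Fintype.sum_sum_type]
    simp only [c, g, τ, Sum.elim_inl, Sum.elim_inr, ofLex_toLex, neg_mul, Finset.sum_neg_distrib]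
    linarith
  have hfib := fiber_sum_eq_zero_of_sum_exp_quadratic c g hzero (g (Sum.inr b₀))
  simp_rw [hg] at hfib
  rw [Fintype.sum_sum_type] at hfib
  have hfib : ∑ a, (if θ a = η b₀ then w a else 0) + ∑ b, (if η b = η b₀ then -p b else 0) = 0 :=
    hfib
  have hneg : ∑ b, (if η b = η b₀ then -p b else 0) = -∑ b, if η b = η b₀ then p b else 0 := by
    rw [← Finset.sum_neg_distrib]
    exact Finset.sum_congr rfl fun b _ => by split_ifs <;> simp
  rw [hneg] at hfib
  linarith

end Identifiability

/-! ## Discrete optimal transport between mixtures -/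

section Transport

variable {n a b : ℕ}

lemma trace_transpose_mul_eq_sum {ι κ : Type*} [Fintype ι] [Fintype κ] (A B : Matrix ι κ ℝ) :
    (Aᵀ * B).trace = ∑ i, ∑ j, A i j * B i j := by
  rw [trace, Finset.sum_comm]
  rfl

lemma mem_transportPlans_iff {p : Fin a → ℝ} {p' : Fin b → ℝ} {M : Matrix (Fin a) (Fin b) ℝ} :
    M ∈ transportPlans p p' ↔
      (∀ i j, 0 ≤ M i j) ∧ (∀ i, ∑ j, M i j = p i) ∧ ∀ j, ∑ i, M i j = p' j := by
  simp [transportPlans, funext_iff, mulVec, dotProduct]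

lemma transportPlans_nonempty {p : Fin a → ℝ} {p' : Fin b → ℝ} (hp : p ∈ stdSimplex ℝ (Fin a))
    (hp' : p' ∈ stdSimplex ℝ (Fin b)) : (transportPlans p p').Nonempty := by
  refine ⟨Matrix.of fun i j => p i * p' j, mem_transportPlans_iff.2 ⟨?_, ?_, ?_⟩⟩
  · exact fun i j => mul_nonneg (hp.1 i) (hp'.1 j)
  · intro i
    simp only [of_apply]
    rw [← Finset.mul_sum, hp'.2, mul_one]
  · intro j
    simp only [of_apply]
    rw [← Finset.sum_mul, hp.2, one_mul]

lemma isCompact_transportPlans (p : Fin a → ℝ) (p' : Fin b → ℝ) :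
    IsCompact (transportPlans p p') := by
  have hcl : IsClosed (transportPlans p p') := by
    have : transportPlans p p' = (⋂ i, ⋂ j, {M | 0 ≤ M i j}) ∩ {M | M *ᵥ 1 = p} ∩
        {M | Mᵀ *ᵥ 1 = p'} := by
      ext M
      simp [transportPlans, and_assoc]
    rw [this]
    refine ((isClosed_iInter fun i => isClosed_iInter fun j => ?_).inter ?_).inter ?_
    · exact isClosed_le continuous_const (by fun_prop)
    · exact isClosed_eq (by fun_prop) continuous_const
    · exact isClosed_eq (by fun_prop) continuous_const
  have hK : IsCompact (Set.univ.pi fun i : Fin a => Set.univ.pi fun _ : Fin b =>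
      Set.Icc (0 : ℝ) (p i)) :=
    isCompact_univ_pi fun _ => isCompact_univ_pi fun _ => isCompact_Icc
  refine hK.of_isClosed_subset hcl ?_
  intro M hM i _ j _
  obtain ⟨h0, h1, -⟩ := mem_transportPlans_iff.1 hM
  refine ⟨h0 i j, ?_⟩
  rw [← h1 i]
  exact Finset.single_le_sum (f := fun j => M i j) (fun k _ => h0 i k) (Finset.mem_univ j)

variable {G : GMM n a} {H : GMM n b}

lemma transportCost_nonneg (hG : ∀ i, (G.cov i).PosSemidef) (hH : ∀ j, (H.cov j).PosDef)
    {M : Matrix (Fin a) (Fin b) ℝ} (hM : M ∈ transportPlans G.weight H.weight) :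
    0 ≤ ∑ i, ∑ j, gaussianWassersteinSq (G.mean i) (G.cov i) (H.mean j) (H.cov j) * M i j :=
  Finset.sum_nonneg fun i _ => Finset.sum_nonneg fun j _ =>
    mul_nonneg (gaussianWassersteinSq_nonneg _ _ (hG i) (hH j)) (hM.1 i j)

/-- Squaring undoes the root only for a nonnegative infimum, which needs the closed-form distance to
be nonnegative. -/
lemma gmmWasserstein_sq (hG : ∀ i, (G.cov i).PosSemidef) (hH : ∀ j, (H.cov j).PosDef) :
    gmmWasserstein G H ^ 2 = sInf ((fun M : Matrix (Fin a) (Fin b) ℝ =>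
      ∑ i, ∑ j, gaussianWassersteinSq (G.mean i) (G.cov i) (H.mean j) (H.cov j) * M i j) ''
        transportPlans G.weight H.weight) := by
  refine Real.sq_sqrt (Real.sInf_nonneg ?_)
  rintro _ ⟨M, hM, rfl⟩
  exact transportCost_nonneg hG hH hM

lemma gmmWasserstein_sq_le (hG : ∀ i, (G.cov i).PosSemidef) (hH : ∀ j, (H.cov j).PosDef)
    {M : Matrix (Fin a) (Fin b) ℝ} (hM : M ∈ transportPlans G.weight H.weight) :
    gmmWasserstein G H ^ 2 ≤
      ∑ i, ∑ j, gaussianWassersteinSq (G.mean i) (G.cov i) (H.mean j) (H.cov j) * M i j := by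
  rw [gmmWasserstein_sq hG hH]
  refine csInf_le ⟨0, ?_⟩ ⟨M, hM, rfl⟩
  rintro _ ⟨M', hM', rfl⟩
  exact transportCost_nonneg hG hH hM'

lemma exists_transportPlan_eq (hG : G.IsValid) (hH : H.IsNondegenerate) :
    ∃ M ∈ transportPlans G.weight H.weight,
      ∑ i, ∑ j, gaussianWassersteinSq (G.mean i) (G.cov i) (H.mean j) (H.cov j) * M i j =
        gmmWasserstein G H ^ 2 := by
  have hcont : Continuous fun M : Matrix (Fin a) (Fin b) ℝ =>
      ∑ i, ∑ j, gaussianWassersteinSq (G.mean i) (G.cov i) (H.mean j) (H.cov j) * M i j := by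
    fun_prop
  obtain ⟨M, hM, hmin⟩ := (isCompact_transportPlans G.weight H.weight).exists_sInf_image_eq
    (transportPlans_nonempty hG.weight_mem hH.weight_mem) hcont.continuousOn
  exact ⟨M, hM, by rw [gmmWasserstein_sq hG.cov_posSemidef hH.cov_posDef, hmin]⟩

/-- Regrouping a family of labelled weights along the labels of a second family with the same
total weight for every label. -/
lemma exists_coupling {r q : ℕ} {X : Type*} [DecidableEq X] {w : Fin r × Fin q → ℝ}
    {p : Fin q → ℝ} (hw : ∀ ij, 0 ≤ w ij) (hp : ∀ j, 0 ≤ p j) (θ : Fin r × Fin q → X)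
    (η : Fin q → X)
    (h₁ : ∀ b, ∑ ij, (if θ ij = η b then w ij else 0) = ∑ j, if η j = η b then p j else 0)
    (h₂ : ∀ ab, ∑ j, (if η j = θ ab then p j else 0) = ∑ ij, if θ ij = θ ab then w ij else 0) :
    ∃ lam : Matrix (Fin r) (Fin q) ℝ, (∀ i j, 0 ≤ lam i j) ∧
      (∀ i, ∑ j, lam i j = ∑ j, w (i, j)) ∧ (∀ j, ∑ i, lam i j = p j) ∧
      ∀ C c : Matrix (Fin r) (Fin q) ℝ, (∀ i j j', θ (i, j) = η j' → C i j' ≤ c i j) →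
        ∑ i, ∑ j, C i j * lam i j ≤ ∑ i, ∑ j, w (i, j) * c i j := by
  let P : X → ℝ := fun x => ∑ j, if η j = x then p j else 0
  have hP0 : ∀ x, 0 ≤ P x := fun x => Finset.sum_nonneg fun j _ => by
    split_ifs
    exacts [hp j, le_rfl]
  -- The share of branch `(i, j)` sent to `j'`: only components with the label of the branch receive
  -- weight, each in proportion to `p j'`. This resolves repeated labels.
  let ρ : Fin r → Fin q → Fin q → ℝ := fun i j j' =>
    if η j' = θ (i, j) then p j' / P (η j') else 0
  have hρ0 : ∀ i j j', 0 ≤ ρ i j j' := by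
    intro i j j'
    simp only [ρ]
    split_ifs
    exacts [div_nonneg (hp _) (hP0 _), le_rfl]
  have hwP : ∀ ij, w ij ≤ P (θ ij) := by
    intro ij
    change w ij ≤ ∑ j, if η j = θ ij then p j else 0
    rw [h₂]
    have := Finset.single_le_sum (f := fun ab => if θ ab = θ ij then w ab else 0)
      (fun ab _ => by split_ifs; exacts [hw ab, le_rfl]) (Finset.mem_univ ij)
    simpa using this
  have hrow : ∀ i j, w (i, j) * ∑ j', ρ i j j' = w (i, j) := by
    intro i j
    have hsum : ∑ j', ρ i j j' = P (θ (i, j)) / P (θ (i, j)) := by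
      change _ = (∑ j', if η j' = θ (i, j) then p j' else 0) / _
      rw [Finset.sum_div]
      refine Finset.sum_congr rfl fun j' _ => ?_
      simp only [ρ]
      split_ifs with h
      · rw [h]
      · rw [zero_div]
    rw [hsum]
    -- If the label has total weight zero, the quotients take the value zero by convention, but then
    -- the branch itself has weight zero.
    rcases eq_or_ne (P (θ (i, j))) 0 with h | h
    · have : w (i, j) = 0 := le_antisymm (h ▸ hwP (i, j)) (hw _)
      rw [this, zero_mul]
    · rw [div_self h, mul_one]
  have hcol : ∀ j', ∑ i, ∑ j, w (i, j) * ρ i j j' = p j' := by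
    intro j'
    have h3 : ∀ i j, w (i, j) * ρ i j j' =
        (if θ (i, j) = η j' then w (i, j) else 0) * (p j' / P (η j')) := by
      intro i j
      simp only [ρ, eq_comm (a := η j')]
      split_ifs <;> simp
    simp_rw [h3]
    rw [← Fintype.sum_prod_type' (f := fun i j =>
      (if θ (i, j) = η j' then w (i, j) else 0) * (p j' / P (η j'))), ← Finset.sum_mul]
    have h4 : ∑ ij : Fin r × Fin q, (if θ (ij.1, ij.2) = η j' then w (ij.1, ij.2) else 0) =
        P (η j') := h₁ j'
    rw [h4]
    rcases eq_or_ne (P (η j')) 0 with h | h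
    · have : p j' ≤ P (η j') := by
        have := Finset.single_le_sum (f := fun b => if η b = η j' then p b else 0)
          (fun b _ => by split_ifs; exacts [hp b, le_rfl]) (Finset.mem_univ j')
        simpa using this
      rw [h, zero_mul]
      exact le_antisymm (hp j') (h ▸ this)
    · rw [mul_div_cancel₀ _ h]
  refine ⟨Matrix.of fun i j' => ∑ j, w (i, j) * ρ i j j', ?_, ?_, ?_, ?_⟩
  · intro i j'
    simp only [of_apply]
    exact Finset.sum_nonneg fun j _ => mul_nonneg (hw _) (hρ0 _ _ _)
  · intro i
    simp only [of_apply]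
    rw [Finset.sum_comm]
    exact Finset.sum_congr rfl fun j _ => by rw [← Finset.mul_sum, hrow]
  · exact hcol
  · intro C c hC
    refine Finset.sum_le_sum fun i _ => ?_
    simp only [of_apply, Finset.mul_sum]
    rw [Finset.sum_comm]
    refine Finset.sum_le_sum fun j _ => ?_
    calc ∑ j', C i j' * (w (i, j) * ρ i j j') ≤ ∑ j', w (i, j) * ρ i j j' * c i j := by
          refine Finset.sum_le_sum fun j' _ => ?_
          by_cases h : η j' = θ (i, j)
          · rw [mul_comm]
            exact mul_le_mul_of_nonneg_left (hC i j j' h.symm) (mul_nonneg (hw _) (hρ0 _ _ _))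
          · simp [ρ, h]
      _ = w (i, j) * c i j := by rw [← Finset.sum_mul, ← Finset.mul_sum, hrow]

end Transport

/-! ## Equivalence of density steering and the bilinear program -/

section Equivalence

variable {n m N r q t : ℕ} {sys : LinearSystem n m N} {cost : QuadraticCost n m N}
  {init : GMM n r} {target : GMM n t} {κ : ℝ} {D : Matrix (Fin m × Fin N) (Fin (m * N - n)) ℝ}
  (hctrl : IsUnit sys.gramian) (hR : ∀ k, (cost.R k).PosDef) (hQ : ∀ k, (cost.Q k).PosSemidef)
  (hinit : init.IsNondegenerate) (htarget : target.IsNondegenerate)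
  (hD : D.rank = m * N - n) (hBD : sys.BN * D = 0)

section
include hctrl hR hQ hinit htarget hD hBD

/-- The inequalities for `C` and `T` are taken with equality, at an optimal `L`, an optimal `Y` and
an optimal transport plan. Only the weights `lam` depend on how the branches reach the terminal
mixture. -/
lemma exists_bilinearFeasible_of_steeringFeasible {pol : PolicyParams n m N r q} {G : GMM n q}
    (h : SteeringFeasible sys cost init κ pol G) :
    ∃ s : BilinearVars n r q t, BilinearFeasible sys cost init target κ D s ∧
      s.terminal = G ∧ s.objective = gmmWasserstein G target ^ 2 := by
  classical
  have hpol := h.admissible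
  have hS : ∀ i j, (terminalCov sys init pol i j).PosSemidef := fun i j =>
    posSemidef_mul_mul_transpose (hinit.cov_posDef i).posSemidef _
  have hw : ∀ ij : Fin r × Fin q, 0 ≤ init.weight ij.1 * pol.weight ij.1 ij.2 := fun ij =>
    mul_nonneg (hinit.weight_mem.1 _) ((hpol _).1 _)
  have hlaw : ∑ ij : Fin r × Fin q, ENNReal.ofReal (init.weight ij.1 * pol.weight ij.1 ij.2) •
      multivariateGaussian (terminalMean sys init pol ij.1 ij.2)
        (terminalCov sys init pol ij.1 ij.2) =
      ∑ j, ENNReal.ofReal (G.weight j) • multivariateGaussian (G.mean j) (G.cov j) := by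
    rw [Fintype.sum_prod_type, ← terminalLaw_eq_sum sys hinit hpol, h.terminal_law]
    rfl
  obtain ⟨lam, hlam0, hlamrow, hlamcol, hlamcost⟩ := exists_coupling hw h.terminal_valid.weight_mem.1
    (fun ij => (terminalMean sys init pol ij.1 ij.2, terminalCov sys init pol ij.1 ij.2))
    (fun j => (G.mean j, G.cov j))
    (fiber_weight_eq_of_mixture_eq hw h.terminal_valid.weight_mem.1 (fun ij => hS ij.1 ij.2)
      h.terminal_valid.cov_posSemidef hlaw)
    (fiber_weight_eq_of_mixture_eq h.terminal_valid.weight_mem.1 hw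
      h.terminal_valid.cov_posSemidef (fun ij => hS ij.1 ij.2) hlaw.symm)
  -- A single `X`, taken from an optimal gain, must bound the cost of every admissible gain: several
  -- branches of the policy may be rerouted to the same pair of components.
  have hL : ∀ i j, ∃ X : Matrix (Fin n) (Fin n) ℝ, (fromBlocks
      (Theta8 sys cost D * G.cov j * (Theta8 sys cost D)ᵀ) X Xᵀ (init.cov i)).PosSemidef ∧
      ∀ L ∈ covSteeringSet sys (init.cov i) (G.cov j),
        (Theta6 sys cost D * G.cov j).trace + (Theta7 sys cost D * init.cov i).trace +
          (X + Xᵀ).trace ≤ covCost sys cost (init.cov i) L := by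
    intro i j
    obtain ⟨L₀, hL₀, -⟩ := exists_isCovSteeringSolution hctrl hR hQ hD hBD (hinit.cov_posDef i)
      (h.terminal_valid.cov_posSemidef j)
    obtain ⟨X, hX, hle⟩ := exists_fromBlocks_le_covCost hctrl hR hQ hD hBD
      (hinit.cov_posDef i).posSemidef hL₀.1
    exact ⟨X, hX, fun L hL => hle.trans (hL₀.2 hL)⟩
  choose L hLblock hLle using hL
  choose Y hYblock hYeq using fun i j => exists_fromBlocks_gaussianWassersteinSq_eq (G.mean i)
    (target.mean j) (h.terminal_valid.cov_posSemidef i) (htarget.cov_posDef j)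
  obtain ⟨β, hβ, hβeq⟩ := exists_transportPlan_eq h.terminal_valid htarget
  refine ⟨{ lam := lam
            C := Matrix.of fun i j => meanCostOpt sys cost (init.mean i) (G.mean j) +
              (Theta6 sys cost D * G.cov j).trace + (Theta7 sys cost D * init.cov i).trace +
              (L i j + (L i j)ᵀ).trace
            beta := β
            T := Matrix.of fun i j =>
              gaussianWassersteinSq (G.mean i) (G.cov i) (target.mean j) (target.cov j)
            L := L
            Y := Y
            terminal := G }, ?_, rfl, ?_⟩
  · refine ⟨?_, ?_, hlam0, hβ.2.1, hβ.2.2, hβ.1, fun i j => le_rfl, hLblock,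
      fun i j => (hYeq i j).le, hYblock, ?_⟩
    · ext i
      have h1 := hlamrow i
      simp only at h1
      rw [← Finset.mul_sum, (hpol i).2, mul_one] at h1
      simpa [mulVec, dotProduct] using h1
    · ext j
      simpa [mulVec, dotProduct] using hlamcol j
    · rw [trace_transpose_mul_eq_sum]
      refine (hlamcost _ (Matrix.of fun i j =>
        meanCost sys cost (init.mean i) (pol.feedforward i j) +
          covCost sys cost (init.cov i) (pol.gain i j)) fun i j j' hij => ?_).trans ?_
      · obtain ⟨hm, hc⟩ := Prod.ext_iff.1 hij
        have h1 := meanCostOpt_le hctrl hR hQ (μ₀ := init.mean i) (μd := G.mean j')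
          (U := pol.feedforward i j) (congrArg WithLp.ofLp hm).symm
        have h2 := hLle i j' (pol.gain i j) hc.symm
        simp only [of_apply]
        linarith
      · have := h.cost_le
        rwa [(integral_realizedCost sys hR hQ hinit hpol).2] at this
  · rw [BilinearVars.objective, trace_transpose_mul_eq_sum]
    exact hβeq

variable {s : BilinearVars n r q t} (hs : BilinearFeasible sys cost init target κ D s)
include hs

-- The program does not state that the terminal covariances are positive semidefinite. It follows
-- from the upper left block of the `Y` constraint, which is present because the target weights sum
-- to one and so there is at least one target component.
omit hctrl hR hQ htarget hD hBD in
lemma terminal_isValid_of_bilinearFeasible (htarget : target.weight ∈ stdSimplex ℝ (Fin t)) :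
    s.terminal.IsValid := by
  refine ⟨⟨fun j => ?_, ?_⟩, fun i => ?_⟩
  · rw [← hs.lam_col]
    simp only [mulVec, dotProduct, transpose_apply, Pi.one_apply, mul_one]
    exact Finset.sum_nonneg fun i _ => hs.lam_nonneg i j
  · rw [← hs.lam_col]
    simp only [mulVec, dotProduct, transpose_apply, Pi.one_apply, mul_one]
    rw [Finset.sum_comm, ← hinit.weight_mem.2, ← hs.lam_row]
    simp [mulVec, dotProduct]
  · have hne : Nonempty (Fin t) := by
      by_contra hemp
      rw [not_nonempty_iff] at hemp
      have := htarget.2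
      simp at this
    obtain ⟨j⟩ := hne
    exact (hs.Y_block i j).submatrix Sum.inl

lemma exists_isRecoveredPolicy :
    ∃ pol : PolicyParams n m N r q, IsRecoveredPolicy sys cost init s pol := by
  have hvalid := terminal_isValid_of_bilinearFeasible hinit hs htarget.weight_mem
  choose L hL _ using fun i j => exists_isCovSteeringSolution hctrl hR hQ hD hBD
    (hinit.cov_posDef i) (hvalid.cov_posSemidef j)
  have hrow : ∀ i, ∃ v ∈ stdSimplex ℝ (Fin q),
      init.weight i ≠ 0 → ∀ j, v j = s.lam i j / init.weight i := by
    intro i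
    by_cases hi : init.weight i = 0
    -- For a component of weight zero any probability vector will do; the terminal weights provide
    -- one.
    · exact ⟨_, hvalid.weight_mem, fun h => absurd hi h⟩
    · refine ⟨fun j => s.lam i j / init.weight i,
        ⟨fun j => div_nonneg (hs.lam_nonneg i j) (hinit.weight_mem.1 i), ?_⟩, fun _ _ => rfl⟩
      have hsum : ∑ j, s.lam i j = init.weight i := by
        simpa [mulVec, dotProduct] using congrFun hs.lam_row i
      rw [← Finset.sum_div, hsum, div_self hi]
  choose v hv hveq using hrow
  exact ⟨{ weight := Matrix.of v
           gain := L
           feedforward := fun i j => meanControl sys cost (init.mean i) (s.terminal.mean j) },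
    hv, fun i j hi => hveq i hi j, fun i j => isMeanSteeringSolution_meanControl hctrl hR hQ _ _, hL⟩

lemma steeringFeasible_of_isRecoveredPolicy {pol : PolicyParams n m N r q}
    (hpol : IsRecoveredPolicy sys cost init s pol) :
    SteeringFeasible sys cost init κ pol s.terminal := by
  have hvalid := terminal_isValid_of_bilinearFeasible hinit hs htarget.weight_mem
  have hrow : ∀ i, ∑ j, s.lam i j = init.weight i := fun i => by
    simpa [mulVec, dotProduct] using congrFun hs.lam_row i
  have hcol : ∀ j, ∑ i, s.lam i j = s.terminal.weight j := fun j => by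
    simpa [mulVec, dotProduct] using congrFun hs.lam_col j
  have hw : ∀ i j, init.weight i * pol.weight i j = s.lam i j := by
    intro i j
    -- If `pᵢ⁰ = 0`, the row sum forces the whole row of `lam` to vanish, so the arbitrary row of
    -- the policy does no harm.
    by_cases hi : init.weight i = 0
    · have h1 := hrow i
      rw [hi, Finset.sum_eq_zero_iff_of_nonneg fun j _ => hs.lam_nonneg i j] at h1
      rw [hi, zero_mul, h1 j (Finset.mem_univ j)]
    · rw [hpol.weight_eq i j hi, mul_div_cancel₀ _ hi]
  have hmean : ∀ i j, terminalMean sys init pol i j = s.terminal.mean j := by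
    intro i j
    have h1 : (s.terminal.mean j).ofLp = _ := (hpol.feedforward_opt i j).1
    rw [terminalMean, ← h1]
  have hcov : ∀ i j, terminalCov sys init pol i j = s.terminal.cov j := fun i j =>
    ((hpol.gain_opt i j).1).symm
  obtain ⟨hint, hval⟩ := integral_realizedCost sys hR hQ hinit hpol.admissible
  refine ⟨hpol.admissible, hvalid, ?_, hint, ?_⟩
  · rw [terminalLaw_eq_sum sys hinit hpol.admissible, Finset.sum_comm, GMM.law]
    refine Finset.sum_congr rfl fun j _ => ?_
    -- All branches with the same `j` now carry the same Gaussian, so their weights add up to the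
    -- `j`-th terminal weight.
    simp_rw [hmean, hcov, hw]
    rw [← Finset.sum_smul, ← ENNReal.ofReal_sum_of_nonneg fun i _ => hs.lam_nonneg i j, hcol]
  · refine le_trans (le_of_eq hval) (le_trans ?_ hs.cost_le)
    rw [trace_transpose_mul_eq_sum]
    refine Finset.sum_le_sum fun i _ => Finset.sum_le_sum fun j _ => ?_
    rw [hw, mul_comm]
    refine mul_le_mul_of_nonneg_right (le_trans ?_ (hs.C_ge i j)) (hs.lam_nonneg i j)
    have h1 := meanCost_le_of_isMeanSteeringSolution hctrl hR hQ (hpol.feedforward_opt i j)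
    have h2 := covCost_le_of_isCovSteeringSolution hctrl hR hQ hD hBD (hinit.cov_posDef i)
      (hvalid.cov_posSemidef j) (hpol.gain_opt i j) (hs.L_block i j)
    linarith

-- `s.beta` is a transport plan, and each `T i j` dominates the Gaussian distance by the
-- semidefinite bound; neither need be optimal.
omit hctrl hR hQ hD hBD in
lemma gmmWasserstein_sq_le_objective : gmmWasserstein s.terminal target ^ 2 ≤ s.objective := by
  have hvalid := terminal_isValid_of_bilinearFeasible hinit hs htarget.weight_mem
  refine (gmmWasserstein_sq_le hvalid.cov_posSemidef htarget.cov_posDef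
    (M := s.beta) ⟨hs.beta_nonneg, hs.beta_row, hs.beta_col⟩).trans ?_
  rw [BilinearVars.objective, trace_transpose_mul_eq_sum]
  refine Finset.sum_le_sum fun i _ => Finset.sum_le_sum fun j _ => ?_
  refine mul_le_mul_of_nonneg_right (le_trans ?_ (hs.T_ge i j)) (hs.beta_nonneg i j)
  exact gaussianWassersteinSq_le_of_fromBlocks _ _ (hvalid.cov_posSemidef i)
    (htarget.cov_posDef j) (hs.Y_block i j)

end

end Equivalence

end GMMSteering

end

/-! ### Comparison of the optimal values and minimizers of the two problems -/

theorem theorem3 {n m N r q t : ℕ} (hN : 0 < N)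
    (sys : LinearSystem n m N) (hctrl : IsUnit sys.gramian)
    (cost : QuadraticCost n m N)
    (hR : ∀ k, (cost.R k).PosDef) (hQ : ∀ k, (cost.Q k).PosSemidef)
    (init : GMM n r) (hinit : init.IsNondegenerate)
    (target : GMM n t) (htarget : target.IsNondegenerate)
    (κ : ℝ) (hκ : 0 < κ)
    (D : Matrix (Fin m × Fin N) (Fin (m * N - n)) ℝ)
    (hD : D.rank = m * N - n) (hBD : sys.BN * D = 0) :
    -- the two problems have the same optimal value (and are feasible together)
    ((steeringValues sys cost init target κ q).Nonempty ↔
      (bilinearValues sys cost init target κ q D).Nonempty) ∧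
    (∀ v : ℝ, IsGLB (steeringValues sys cost init target κ q) v ↔
      IsGLB (bilinearValues sys cost init target κ q D) v) ∧
    -- every feasible policy corresponds to a feasible point with the same value
    (∀ (pol : PolicyParams n m N r q) (G : GMM n q), SteeringFeasible sys cost init κ pol G →
      ∃ s : BilinearVars n r q t, BilinearFeasible sys cost init target κ D s ∧
        s.terminal = G ∧ s.objective = gmmWasserstein G target ^ 2) ∧
    -- every feasible point yields feasible policies whose value is at most as large
    (∀ s : BilinearVars n r q t, BilinearFeasible sys cost init target κ D s →
      (∃ pol : PolicyParams n m N r q, IsRecoveredPolicy sys cost init s pol) ∧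
      ∀ pol : PolicyParams n m N r q, IsRecoveredPolicy sys cost init s pol →
        SteeringFeasible sys cost init κ pol s.terminal ∧
        gmmWasserstein s.terminal target ^ 2 ≤ s.objective) ∧
    -- minimizers of the program yield optimal policies
    (∀ s : BilinearVars n r q t, BilinearOptimal sys cost init target κ D s →
      gmmWasserstein s.terminal target ^ 2 = s.objective ∧
      ∀ pol : PolicyParams n m N r q, IsRecoveredPolicy sys cost init s pol →
        SteeringOptimal sys cost init target κ pol s.terminal) ∧
    -- the terminal mixture of every optimal policy comes from a minimizer of the program
    (∀ (pol : PolicyParams n m N r q) (G : GMM n q),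
      SteeringOptimal sys cost init target κ pol G →
      ∃ s : BilinearVars n r q t, BilinearOptimal sys cost init target κ D s ∧
        s.terminal = G ∧ s.objective = gmmWasserstein G target ^ 2) := by
  have hto : ∀ (pol : PolicyParams n m N r q) (G : GMM n q),
      SteeringFeasible sys cost init κ pol G →
      ∃ s : BilinearVars n r q t, BilinearFeasible sys cost init target κ D s ∧
        s.terminal = G ∧ s.objective = gmmWasserstein G target ^ 2 := fun _ _ h =>
    exists_bilinearFeasible_of_steeringFeasible hctrl hR hQ hinit htarget hD hBD h
  have hrec : ∀ s : BilinearVars n r q t, BilinearFeasible sys cost init target κ D s →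
      ∃ pol : PolicyParams n m N r q, IsRecoveredPolicy sys cost init s pol := fun _ hs =>
    exists_isRecoveredPolicy hctrl hR hQ hinit htarget hD hBD hs
  have hfrom : ∀ s : BilinearVars n r q t, BilinearFeasible sys cost init target κ D s →
      ∀ pol : PolicyParams n m N r q, IsRecoveredPolicy sys cost init s pol →
        SteeringFeasible sys cost init κ pol s.terminal ∧
        gmmWasserstein s.terminal target ^ 2 ≤ s.objective := fun _ hs _ hpol =>
    ⟨steeringFeasible_of_isRecoveredPolicy hctrl hR hQ hinit htarget hD hBD hs hpol,
      gmmWasserstein_sq_le_objective hinit htarget hs⟩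
  have hsub : steeringValues sys cost init target κ q ⊆
      bilinearValues sys cost init target κ q D := by
    rintro _ ⟨pol, G, h, rfl⟩
    obtain ⟨s, hs, -, hobj⟩ := hto pol G h
    exact ⟨s, hs, hobj.symm⟩
  have hdom : ∀ v ∈ bilinearValues sys cost init target κ q D,
      ∃ u ∈ steeringValues sys cost init target κ q, u ≤ v := by
    rintro _ ⟨s, hs, rfl⟩
    obtain ⟨pol, hpol⟩ := hrec s hs
    obtain ⟨hfeas, hle⟩ := hfrom s hs pol hpol
    exact ⟨_, ⟨pol, _, hfeas, rfl⟩, hle⟩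
  -- The steering values are among the bilinear values, and each bilinear value dominates a steering
  -- value. So both sets have the same lower bounds, which determine the infimum without assuming
  -- that it is attained.
  have hlower : lowerBounds (steeringValues sys cost init target κ q) =
      lowerBounds (bilinearValues sys cost init target κ q D) := by
    refine Set.Subset.antisymm (fun v hv u hu => ?_) (lowerBounds_mono_set hsub)
    obtain ⟨u', hu', hle⟩ := hdom u hu
    exact (hv hu').trans hle
  refine ⟨⟨fun h => h.mono hsub, ?_⟩, fun v => ?_, hto, fun s hs => ⟨hrec s hs, hfrom s hs⟩,
    fun s hs => ?_, fun pol G h => ?_⟩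
  · rintro ⟨v, hv⟩
    obtain ⟨u, hu, -⟩ := hdom v hv
    exact ⟨u, hu⟩
  · rw [IsGLB, IsGLB, hlower]
  · have hmin : ∀ (pol' : PolicyParams n m N r q) (G' : GMM n q),
        SteeringFeasible sys cost init κ pol' G' →
        s.objective ≤ gmmWasserstein G' target ^ 2 := by
      intro pol' G' h'
      obtain ⟨s', hs', -, hobj⟩ := hto pol' G' h'
      exact hobj ▸ hs.2 s' hs'
    have heq : gmmWasserstein s.terminal target ^ 2 = s.objective := by
      obtain ⟨pol, hpol⟩ := hrec s hs.1
      obtain ⟨hfeas, hle⟩ := hfrom s hs.1 pol hpol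
      exact le_antisymm hle (hmin pol _ hfeas)
    exact ⟨heq, fun pol hpol => ⟨(hfrom s hs.1 pol hpol).1, fun pol' G' h' =>
      heq.le.trans (hmin pol' G' h')⟩⟩
  · obtain ⟨s, hs, hterm, hobj⟩ := hto pol G h.1
    refine ⟨s, ⟨hs, fun s' hs' => ?_⟩, hterm, hobj⟩
    obtain ⟨pol', hpol'⟩ := hrec s' hs'
    obtain ⟨hfeas, hle⟩ := hfrom s' hs' pol' hpol'
    exact hobj.le.trans ((h.2 pol' _ hfeas).trans hle)
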